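/- There is a universal constant $C>0$ such that for every $n\ge 1$ the quantity $\tilde K_n$ below is finite and every log-concave measure $\mu$ on $\mathbb R^n$ that is $1$ tilt-stable is $C\,n^{1/6}\tilde K_n^{1/3}$ strongly tilt-stable. Here a measure $\mu$ on $\mathbb R^n$ is log-concave if $d\mu=e^{-V(x)}dx$ for some convex $V:\mathbb R^n\to\mathbb R\cup\{+\infty\}$. For $\beta>0$, $\mu$ is $\beta$ tilt-stable if for all $h\in\mathbb R^n$ the probability measure $\tau_h\mu=\frac1{Z_h}e^{h\cdot x}\mu$ is well defined (that is, $0<Z_h=\int e^{h\cdot x}d\mu<\infty$) and $\|\mathrm{Cov}(\tau_h\mu)\|_{op}\le\beta^2$. It is $\beta$ strongly tilt-stable if for all $t>0$ and $h\in\mathbb R^n$ the probability measure $\mu_{t,h}=\frac1{Z_{t,h}}e^{-t|x|^2+h\cdot x}\mu$ is well defined (with $0<Z_{t,h}=\int e^{-t|x|^2+h\cdot x}d\mu<\infty$) and $\|\mathrm{Cov}(\mu_{t,h})\|_{op}\le\beta^2$. Finally, $$\tilde K_n=\sup_\mu\big\|\,|X|-\mathbb E|X|\,\big\|_{\Psi_2},\qquad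 X\sim\mu,\qquad \|Y\|_{\Psi_2}=\inf\{s>0:\ \mathbb E\,e^{Y^2/s^2}\le 2\},$$ where $|\cdot|$ is the Euclidean norm and the supremum runs over all $1$ tilt-stable log-concave probability measures $\mu$ on $\mathbb R^n$. -/

import Mathlib

open MeasureTheory ProbabilityTheory
open scoped ENNReal RealInnerProductSpace

namespace TiltStability

/-- A measure on `ℝⁿ` is log-concave if `dμ = e^{-V} dx` for a convex `V : ℝⁿ → ℝ ∪ {+∞}`.
Such a function is given by its domain `K = {V < +∞}`, a convex set, and by a real-valued convex
function on `K`; outside `K` the density is `e^{-∞} = 0`. -/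
def IsLogConcave {n : ℕ} (μ : Measure (EuclideanSpace ℝ (Fin n))) : Prop :=
  ∃ (K : Set (EuclideanSpace ℝ (Fin n))) (V : EuclideanSpace ℝ (Fin n) → ℝ),
    ConvexOn ℝ K V ∧
      μ = volume.withDensity (K.indicator fun x => ENNReal.ofReal (Real.exp (-V x)))

/-- The probability measure `Z⁻¹ e^g μ` is well defined: the normalizing constant
`Z = ∫ e^g dμ` is finite and positive. (The measure itself is then Mathlib's `μ.tilted g`.) -/
def HasTilt {n : ℕ} (μ : Measure (EuclideanSpace ℝ (Fin n)))
    (g : EuclideanSpace ℝ (Fin n) → ℝ) : Prop :=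
  Integrable (fun x => Real.exp (g x)) μ ∧ 0 < ∫ x, Real.exp (g x) ∂μ

/-- `μ` is `β` tilt-stable: `β > 0`, all the tilts `τ_h μ = Z_h⁻¹ e^{h·x} μ` are well defined, and
the operator norm of the covariance of each of them is at most `β²`. (The covariance is the
centered one, as a bilinear form on Euclidean space; its norm is the operator norm of the
covariance matrix. When all tilts are well defined, each of them has moments of all orders.) -/
def IsTiltStable {n : ℕ} (β : ℝ) (μ : Measure (EuclideanSpace ℝ (Fin n))) : Prop :=
  0 < β ∧ ∀ h : EuclideanSpace ℝ (Fin n),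
    HasTilt μ (fun x => ⟪h, x⟫) ∧
      ‖covarianceBilin (μ.tilted fun x => ⟪h, x⟫)‖ ≤ β ^ 2

/-- `μ` is `β` strongly tilt-stable: `β > 0`, and for all `t > 0` and `h` the measure
`μ_{t,h} = Z_{t,h}⁻¹ e^{-t|x|² + h·x} μ` is well defined with a covariance of operator norm at
most `β²`. -/
def IsStronglyTiltStable {n : ℕ} (β : ℝ) (μ : Measure (EuclideanSpace ℝ (Fin n))) : Prop :=
  0 < β ∧ ∀ t : ℝ, 0 < t → ∀ h : EuclideanSpace ℝ (Fin n),
    HasTilt μ (fun x => -t * ‖x‖ ^ 2 + ⟪h, x⟫) ∧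
      ‖covarianceBilin (μ.tilted fun x => -t * ‖x‖ ^ 2 + ⟪h, x⟫)‖ ≤ β ^ 2

/-- The `Ψ₂` norm `inf {s > 0 | ∫ exp (f² / s²) dμ ≤ 2}` of `f` under `μ`, with value `∞` when
there is no such `s`. -/
noncomputable def psiTwoNorm {n : ℕ} (μ : Measure (EuclideanSpace ℝ (Fin n)))
    (f : EuclideanSpace ℝ (Fin n) → ℝ) : ℝ≥0∞ :=
  ⨅ (s : ℝ) (_ : 0 < s) (_ : ∫⁻ x, ENNReal.ofReal (Real.exp (f x ^ 2 / s ^ 2)) ∂μ ≤ 2),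
    ENNReal.ofReal s

/-- `K̃_n`: the supremum of `‖ |X| - 𝔼|X| ‖_{Ψ₂}`, `X ∼ μ`, over all log-concave probability
measures `μ` on `ℝⁿ` that are `1` tilt-stable. -/
noncomputable def tildeK (n : ℕ) : ℝ≥0∞ :=
  ⨆ (μ : Measure (EuclideanSpace ℝ (Fin n))) (_ : IsProbabilityMeasure μ) (_ : IsLogConcave μ)
    (_ : IsTiltStable 1 μ), psiTwoNorm μ (fun x => ‖x‖ - ∫ y, ‖y‖ ∂μ)

end TiltStability

/-! Write K for the real value of `tildeK n` and p = n^{1/6} K^{1/3}, so p³ = √n K. Two bounds on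
Cov(μ_{t,h}) are played against each other at t = p⁻².

For large t, the density of μ_{t,h} is a Gaussian e^{-t|x|²} times a log-concave function, so its
covariance is at most 1/t (`norm_covarianceBilin_tilted_le`). This follows from Prékopa–Leindler for
midpoints, which bounds the product of the exponential moments in directions θ and -θ.

For small t, completing the square reduces to h = 0 and a centered measure ν
(`exists_centered_covarianceBilin_eq`): ν is a translate of the linear tilt τ_w μ, whose barycenter
b satisfies w + 2tb = h. Log-concavity and 1 tilt-stability pass to ν, so |X| concentrates around m
= E|X| ≤ √n at scale K. Hence e^{-t|x|²} is close to the constant e^{-tm²}, and the fluctuation is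
absorbed by the Ψ₂ bound. Since the marginals of ν are sub-Gaussian, E e^{⟨θ,x⟩²/8} under the
Gaussian tilt is at most exp(1 + O(t²nK² + t√n K)), and Jensen turns the exponent into a covariance
bound (`IsTiltStable.integral_sq_tilted_le`). For t ≤ p⁻² this is O(1 + p² + p).

It remains to absorb 1 and p into p², that is, to bound K below. An explicit Gaussian gives K ≥
1/100 (`le_tildeK`). Finiteness of K comes from the sub-Gaussian coordinates (`tildeK_ne_top`). -/

namespace TiltStability

section

/-! ### The Prékopa–Leindler inequality -/

/-- One-dimensional Brunn–Minkowski inequality for compact sets. -/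
lemma volume_add_le_of_isCompact {A B D : Set ℝ} (hA : IsCompact A) (hB : IsCompact B)
    (hA0 : A.Nonempty) (hB0 : B.Nonempty) (h : ∀ a ∈ A, ∀ b ∈ B, a + b ∈ D) :
    volume A + volume B ≤ volume D := by
  obtain ⟨a, haA, ha⟩ := hA.exists_isGreatest hA0
  obtain ⟨b, hbB, hb⟩ := hB.exists_isLeast hB0
  have hA' : volume ((fun x => x + b) '' A) = volume A := by
    rw [Set.image_add_right, measure_preimage_add_right]
  have hB' : volume ((fun x => a + x) '' B) = volume B := by
    rw [Set.image_add_left, measure_preimage_add]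
  have hmeas : MeasurableSet ((fun x => a + x) '' B) :=
    (hB.image (by fun_prop)).measurableSet
  -- The translates A + min B and max A + B both lie in D and meet only at max A + min B.
  rw [← hA', ← hB', ← measure_union₀ hmeas.nullMeasurableSet]
  · refine measure_mono (Set.union_subset ?_ ?_)
    · rintro _ ⟨x, hx, rfl⟩
      exact h x hx b hbB
    · rintro _ ⟨x, hx, rfl⟩
      exact h a haA x hx
  · refine measure_mono_null (t := {a + b}) ?_ (by simp)
    rintro _ ⟨⟨x, hx, rfl⟩, ⟨y, hy, hxy⟩⟩
    have h1 := ha hx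
    have h2 := hb hy
    simp only [Set.mem_singleton_iff] at *
    linarith

/-- One-dimensional Brunn–Minkowski inequality. -/
lemma volume_add_le {A B D : Set ℝ} (hA : MeasurableSet A) (hB : MeasurableSet B)
    (hA0 : A.Nonempty) (hB0 : B.Nonempty) (h : ∀ a ∈ A, ∀ b ∈ B, a + b ∈ D) :
    volume A + volume B ≤ volume D := by
  obtain ⟨a, ha⟩ := hA0
  obtain ⟨b, hb⟩ := hB0
  rw [hA.measure_eq_iSup_isCompact, hB.measure_eq_iSup_isCompact]
  simp only [iSup_and']
  refine ENNReal.biSup_add_biSup_le' ⟨∅, by simp⟩ ⟨∅, by simp⟩ ?_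
  rintro K ⟨hKA, hK⟩ L ⟨hLB, hL⟩
  -- Compact approximants may be empty; adjoining a fixed point of each set repairs this.
  refine le_trans (add_le_add (measure_mono (Set.subset_insert a K))
    (measure_mono (Set.subset_insert b L))) ?_
  exact volume_add_le_of_isCompact (hK.insert a) (hL.insert b) (Set.insert_nonempty _ _)
    (Set.insert_nonempty _ _) fun x hx y hy =>
      h x (Set.insert_subset ha hKA hx) y (Set.insert_subset hb hLB hy)

lemma volume_add_le_two_mul {A B D : Set ℝ} (hA : MeasurableSet A) (hB : MeasurableSet B)
    (hA0 : A.Nonempty) (hB0 : B.Nonempty) (h : ∀ a ∈ A, ∀ b ∈ B, (1 / 2 : ℝ) * (a + b) ∈ D) :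
    volume A + volume B ≤ 2 * volume D := by
  have : volume ((fun x => (1 / 2 : ℝ) * x) ⁻¹' D) = 2 * volume D := by
    rw [Real.volume_preimage_mul_left (by norm_num)]
    norm_num
  rw [← this]
  exact volume_add_le hA hB hA0 hB0 h

/-- Normalized one-dimensional Prékopa–Leindler inequality. -/
lemma lintegral_add_lintegral_le {f g h : ℝ → ℝ} (hf : Measurable f) (hg : Measurable g)
    (hh : Measurable h) (hf0 : ∀ x, 0 ≤ f x) (hg0 : ∀ x, 0 ≤ g x) (hh0 : ∀ x, 0 ≤ h x)
    (hf1 : ∀ x, f x ≤ 1) (hg1 : ∀ x, g x ≤ 1)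
    (hfs : ∀ s < 1, ∃ x, s < f x) (hgs : ∀ s < 1, ∃ x, s < g x)
    (hfg : ∀ x y, min (f x) (g y) ≤ h ((1 / 2 : ℝ) * (x + y))) :
    (∫⁻ x, ENNReal.ofReal (f x)) + ∫⁻ x, ENNReal.ofReal (g x) ≤
      2 * ∫⁻ x, ENNReal.ofReal (h x) := by
  rw [lintegral_eq_lintegral_meas_lt _ (Filter.Eventually.of_forall hf0) hf.aemeasurable,
    lintegral_eq_lintegral_meas_lt _ (Filter.Eventually.of_forall hg0) hg.aemeasurable,
    lintegral_eq_lintegral_meas_lt _ (Filter.Eventually.of_forall hh0) hh.aemeasurable]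
  have hmf : Measurable fun t : ℝ => volume {a | t < f a} :=
    Antitone.measurable fun s t hst => measure_mono fun x hx => lt_of_le_of_lt hst hx
  have hmh : Measurable fun t : ℝ => volume {a | t < h a} :=
    Antitone.measurable fun s t hst => measure_mono fun x hx => lt_of_le_of_lt hst hx
  rw [← lintegral_add_left hmf, ← lintegral_const_mul _ hmh]
  refine lintegral_mono fun t => ?_
  -- Brunn–Minkowski fails for an empty set. The common supremum 1 makes the superlevel sets of f
  -- and g nonempty below level 1 and empty from there on.
  by_cases ht : t < 1
  · refine volume_add_le_two_mul (measurableSet_lt measurable_const hf)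
      (measurableSet_lt measurable_const hg) (hfs t ht) (hgs t ht) fun a ha b hb => ?_
    exact lt_of_lt_of_le (lt_min ha hb) (hfg a b)
  · have h1 : {a | t < f a} = ∅ := by
      ext x; simpa using (hf1 x).trans (not_lt.1 ht)
    have h2 : {a | t < g a} = ∅ := by
      ext x; simpa using (hg1 x).trans (not_lt.1 ht)
    simp [h1, h2]

lemma four_mul_mul_le_add_sq (a b : ℝ≥0∞) : 4 * (a * b) ≤ (a + b) ^ 2 := by
  rcases eq_or_ne a ∞ with rfl | ha
  · simp
  rcases eq_or_ne b ∞ with rfl | hb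
  · simp
  lift a to NNReal using ha
  lift b to NNReal using hb
  norm_cast
  have := four_mul_le_pow_two_add (a : ℝ) b
  rw [← NNReal.coe_le_coe]
  push_cast
  linarith

lemma prekopa_leindler_real_of_bounded {f g h : ℝ → ℝ≥0∞} (hf : Measurable f) (hg : Measurable g)
    (hh : Measurable h) {N M : NNReal} (hfN : ∀ x, f x ≤ N) (hgM : ∀ x, g x ≤ M)
    (hfg : ∀ x y, f x * g y ≤ h ((1 / 2 : ℝ) * (x + y)) ^ 2) :
    (∫⁻ x, f x) * ∫⁻ x, g x ≤ (∫⁻ x, h x) ^ 2 := by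
  obtain ⟨a, ha⟩ : ∃ a : NNReal, (a : ℝ≥0∞) = ⨆ x, f x :=
    ⟨(⨆ x, f x).toNNReal, ENNReal.coe_toNNReal
      (ne_top_of_le_ne_top ENNReal.coe_ne_top (iSup_le hfN))⟩
  obtain ⟨b, hb⟩ : ∃ b : NNReal, (b : ℝ≥0∞) = ⨆ x, g x :=
    ⟨(⨆ x, g x).toNNReal, ENNReal.coe_toNNReal
      (ne_top_of_le_ne_top ENNReal.coe_ne_top (iSup_le hgM))⟩
  have hfa : ∀ x, f x ≤ a := fun x => ha ▸ le_iSup f x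
  have hgb : ∀ x, g x ≤ b := fun x => hb ▸ le_iSup g x
  rcases eq_or_ne a 0 with rfl | ha0
  · have : ∀ x, f x = 0 := fun x => by simpa using hfa x
    simp [this]
  rcases eq_or_ne b 0 with rfl | hb0
  · have : ∀ x, g x = 0 := fun x => by simpa using hgb x
    simp [this]
  have key : ∀ (u : ℝ → ℝ≥0∞) (c : NNReal), c ≠ 0 → (∀ x, u x ≤ c) → (c : ℝ≥0∞) = ⨆ x, u x →
      (∀ x, (u x / c).toReal ≤ 1) ∧ (∀ s < 1, ∃ x, s < (u x / c).toReal) ∧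
      (∀ x, ENNReal.ofReal (u x / c).toReal = u x / c) := by
    intro u c hc huc hcs
    have hle : ∀ x, u x / c ≤ 1 := fun x => ENNReal.div_le_of_le_mul (by simpa using huc x)
    have hnt : ∀ x, u x / c ≠ ∞ := fun x => ne_top_of_le_ne_top ENNReal.one_ne_top (hle x)
    refine ⟨fun x => ?_, fun s hs => ?_, fun x => ENNReal.ofReal_toReal (hnt x)⟩
    · simpa using ENNReal.toReal_mono ENNReal.one_ne_top (hle x)
    · rcases lt_or_ge s 0 with hs0 | hs0
      · exact ⟨0, hs0.trans_le ENNReal.toReal_nonneg⟩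
      · have : ENNReal.ofReal s * c < ⨆ x, u x := by
          rw [← hcs]
          calc ENNReal.ofReal s * c < 1 * c := by
                rw [ENNReal.mul_lt_mul_iff_left (by simpa using hc) ENNReal.coe_ne_top]
                simpa using hs
            _ = c := one_mul _
        obtain ⟨x, hx⟩ := lt_iSup_iff.1 this
        refine ⟨x, (ENNReal.ofReal_lt_iff_lt_toReal hs0 (hnt x)).1 ?_⟩
        rwa [ENNReal.lt_div_iff_mul_lt (Or.inl (by simpa using hc)) (Or.inl ENNReal.coe_ne_top)]
  obtain ⟨f1, f2, f3⟩ := key f a ha0 hfa ha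
  obtain ⟨g1, g2, g3⟩ := key g b hb0 hgb hb
  -- Dividing f, g, h by a, b, √(ab) preserves the hypothesis and normalizes both suprema to 1.
  -- Truncating h/c at 1 keeps it finite and costs nothing, as f/a and g/b are at most 1.
  set c : NNReal := NNReal.sqrt (a * b) with hc
  have hc2 : c ^ 2 = a * b := NNReal.sq_sqrt _
  have hc0 : c ≠ 0 := by
    intro h0
    rw [h0] at hc2
    simp [ha0, hb0] at hc2
  have hnt : ∀ z, min (h z / c) 1 ≠ ∞ := fun z =>
    ne_top_of_le_ne_top ENNReal.one_ne_top (min_le_right _ _)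
  have main := lintegral_add_lintegral_le (f := fun x => (f x / a).toReal)
    (g := fun x => (g x / b).toReal) (h := fun x => (min (h x / c) 1).toReal)
    (by fun_prop) (by fun_prop) (by fun_prop) (fun _ => ENNReal.toReal_nonneg)
    (fun _ => ENNReal.toReal_nonneg) (fun _ => ENNReal.toReal_nonneg) f1 g1 f2 g2 (by
      intro x y
      set m := min (f x / a).toReal (g y / b).toReal
      have hm0 : 0 ≤ m := le_min ENNReal.toReal_nonneg ENNReal.toReal_nonneg
      refine (ENNReal.ofReal_le_iff_le_toReal (hnt _)).1 (le_min ?_ ?_)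
      · rw [ENNReal.le_div_iff_mul_le (Or.inl (by simpa using hc0)) (Or.inl ENNReal.coe_ne_top)]
        refine (ENNReal.pow_le_pow_left_iff two_ne_zero).1 ((le_trans ?_ (hfg x y)))
        have e1 : ENNReal.ofReal m ≤ f x / a := by
          rw [← f3 x]; exact ENNReal.ofReal_le_ofReal (min_le_left _ _)
        have e2 : ENNReal.ofReal m ≤ g y / b := by
          rw [← g3 y]; exact ENNReal.ofReal_le_ofReal (min_le_right _ _)
        calc (ENNReal.ofReal m * c) ^ 2 = (ENNReal.ofReal m * a) * (ENNReal.ofReal m * b) := by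
              have : (c : ℝ≥0∞) ^ 2 = a * b := by exact_mod_cast hc2
              rw [mul_pow, this]; ring
          _ ≤ (f x / a * a) * (g y / b * b) := by gcongr
          _ = f x * g y := by
              rw [ENNReal.div_mul_cancel (by simpa using ha0) ENNReal.coe_ne_top,
                ENNReal.div_mul_cancel (by simpa using hb0) ENNReal.coe_ne_top]
      · exact ENNReal.ofReal_le_one.2 ((min_le_left _ _).trans (f1 x)))
  simp only [f3, g3, ENNReal.ofReal_toReal (hnt _)] at main
  have main2 : (∫⁻ x, f x / a) + ∫⁻ x, g x / b ≤ 2 * ∫⁻ x, h x / c :=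
    main.trans (by gcongr; exact min_le_left _ _)
  simp only [div_eq_mul_inv] at main2
  rw [lintegral_mul_const _ hf, lintegral_mul_const _ hg, lintegral_mul_const _ hh] at main2
  set F := ∫⁻ x, f x
  set G := ∫⁻ x, g x
  set H := ∫⁻ x, h x
  -- AM–GM converts the additive inequality into the multiplicative one.
  have h4 : 4 * ((F * (a : ℝ≥0∞)⁻¹) * (G * (b : ℝ≥0∞)⁻¹)) ≤ 4 * (H * (c : ℝ≥0∞)⁻¹) ^ 2 :=
    (four_mul_mul_le_add_sq _ _).trans ((pow_le_pow_left₀ zero_le main2 2).trans_eq (by ring))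
  have h5 := (ENNReal.mul_le_mul_iff_right (by norm_num) (by norm_num)).1 h4
  have hcab : (a : ℝ≥0∞) * b = c ^ 2 := by exact_mod_cast hc2.symm
  have ea : (a : ℝ≥0∞) * (a : ℝ≥0∞)⁻¹ = 1 :=
    ENNReal.mul_inv_cancel (by simpa using ha0) ENNReal.coe_ne_top
  have eb : (b : ℝ≥0∞) * (b : ℝ≥0∞)⁻¹ = 1 :=
    ENNReal.mul_inv_cancel (by simpa using hb0) ENNReal.coe_ne_top
  have ec : (c : ℝ≥0∞) * (c : ℝ≥0∞)⁻¹ = 1 :=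
    ENNReal.mul_inv_cancel (by simpa using hc0) ENNReal.coe_ne_top
  calc F * G = (F * (a : ℝ≥0∞)⁻¹) * (G * (b : ℝ≥0∞)⁻¹) * (a * b) := by
        rw [show (F * (a : ℝ≥0∞)⁻¹) * (G * (b : ℝ≥0∞)⁻¹) * (a * b) =
          F * G * (a * (a : ℝ≥0∞)⁻¹) * (b * (b : ℝ≥0∞)⁻¹) by ring, ea, eb]; simp
    _ ≤ (H * (c : ℝ≥0∞)⁻¹) ^ 2 * (a * b) := by gcongr
    _ = H ^ 2 := by
        rw [hcab, ← mul_pow, mul_assoc, mul_comm (c : ℝ≥0∞)⁻¹, ec, mul_one]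

lemma lintegral_eq_iSup_min {α : Type*} [MeasurableSpace α] {μ : Measure α} {f : α → ℝ≥0∞}
    (hf : Measurable f) : ∫⁻ x, f x ∂μ = ⨆ N : ℕ, ∫⁻ x, min (f x) N ∂μ := by
  rw [← lintegral_iSup (fun N => hf.min measurable_const)
    fun N M h x => min_le_min le_rfl (by exact_mod_cast h)]
  refine lintegral_congr fun x => le_antisymm ?_ (iSup_le fun N => min_le_left _ _)
  rcases eq_or_ne (f x) ∞ with h | h
  · simp [h, ENNReal.iSup_natCast]
  · obtain ⟨N, hN⟩ := ENNReal.exists_nat_gt h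
    exact le_iSup_of_le N (le_min le_rfl hN.le)

/-- One-dimensional **Prékopa–Leindler inequality**, for midpoints. -/
theorem prekopa_leindler_real {f g h : ℝ → ℝ≥0∞} (hf : Measurable f) (hg : Measurable g)
    (hh : Measurable h) (hfg : ∀ x y, f x * g y ≤ h ((1 / 2 : ℝ) * (x + y)) ^ 2) :
    (∫⁻ x, f x) * ∫⁻ x, g x ≤ (∫⁻ x, h x) ^ 2 := by
  rw [lintegral_eq_iSup_min hf, lintegral_eq_iSup_min hg]
  simp only [ENNReal.iSup_mul, ENNReal.mul_iSup]
  refine iSup_le fun N => iSup_le fun M => ?_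
  refine prekopa_leindler_real_of_bounded (hf.min measurable_const) (hg.min measurable_const) hh
    (N := M) (M := N) (fun x => ?_) (fun x => ?_) fun x y => ?_
  · exact (min_le_right _ _).trans (by simp)
  · exact (min_le_right _ _).trans (by simp)
  · exact (mul_le_mul' (min_le_left _ _) (min_le_left _ _)).trans (hfg x y)

/-- **Prékopa–Leindler inequality** on `Fin n → ℝ`, for midpoints. -/
theorem prekopa_leindler_pi {n : ℕ} {f g h : (Fin n → ℝ) → ℝ≥0∞} (hf : Measurable f)
    (hg : Measurable g) (hh : Measurable h)
    (hfg : ∀ x y, f x * g y ≤ h ((1 / 2 : ℝ) • (x + y)) ^ 2) :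
    (∫⁻ x, f x) * ∫⁻ x, g x ≤ (∫⁻ x, h x) ^ 2 := by
  induction n with
  | zero =>
    have e : ∀ u : (Fin 0 → ℝ) → ℝ≥0∞, ∫⁻ x, u x = u 0 := fun u => by
      rw [volume_pi, Measure.pi_of_empty _ 0, lintegral_dirac]
    rw [e, e, e]
    simpa using hfg 0 0
  | succ n ih =>
    let e := MeasurableEquiv.piFinSuccAbove (fun _ : Fin (n + 1) => ℝ) 0
    have he : MeasurePreserving e.symm :=
      (volume_preserving_piFinSuccAbove (fun _ : Fin (n + 1) => ℝ) 0).symm e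
    have hint : ∀ u : (Fin (n + 1) → ℝ) → ℝ≥0∞, Measurable u →
        ∫⁻ x, u x = ∫⁻ a : ℝ, ∫⁻ y : Fin n → ℝ, u (e.symm (a, y)) := fun u hu => by
      rw [← he.lintegral_comp hu, Measure.volume_eq_prod, lintegral_prod]
      exact (hu.comp e.symm.measurable).aemeasurable
    have hm : ∀ u : (Fin (n + 1) → ℝ) → ℝ≥0∞, Measurable u →
        Measurable fun p : ℝ × (Fin n → ℝ) => u (e.symm p) := fun u hu =>
      hu.comp e.symm.measurable
    have hmid : ∀ (a b : ℝ) (x y : Fin n → ℝ), (1 / 2 : ℝ) • (e.symm (a, x) + e.symm (b, y)) =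
        e.symm ((1 / 2 : ℝ) * (a + b), (1 / 2 : ℝ) • (x + y)) := by
      intro a b x y
      ext i
      refine Fin.cases ?_ (fun j => ?_) i <;>
        simp [e, MeasurableEquiv.piFinSuccAbove, Fin.insertNthEquiv, mul_add]
    rw [hint f hf, hint g hg, hint h hh]
    -- The integrals over slices satisfy the one-dimensional hypothesis, by the inductive inequality
    -- applied to the slices.
    refine prekopa_leindler_real (hm f hf).lintegral_prod_right' (hm g hg).lintegral_prod_right'
      (hm h hh).lintegral_prod_right' fun a b => ?_
    refine ih ((hm f hf).comp measurable_prodMk_left) ((hm g hg).comp measurable_prodMk_left)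
      ((hm h hh).comp measurable_prodMk_left) fun x y => ?_
    have := hfg (e.symm (a, x)) (e.symm (b, y))
    rwa [hmid] at this

/-- **Prékopa–Leindler inequality** on Euclidean space, for midpoints. -/
theorem prekopa_leindler {n : ℕ} {f g h : EuclideanSpace ℝ (Fin n) → ℝ≥0∞} (hf : Measurable f)
    (hg : Measurable g) (hh : Measurable h)
    (hfg : ∀ x y, f x * g y ≤ h ((1 / 2 : ℝ) • (x + y)) ^ 2) :
    (∫⁻ x, f x) * ∫⁻ x, g x ≤ (∫⁻ x, h x) ^ 2 := by
  have e : ∀ u : EuclideanSpace ℝ (Fin n) → ℝ≥0∞, Measurable u →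
      ∫⁻ x, u x = ∫⁻ y : Fin n → ℝ, u (WithLp.toLp 2 y) := fun u hu =>
    ((PiLp.volume_preserving_toLp (Fin n)).lintegral_comp hu).symm
  have hm : Measurable (WithLp.toLp 2 : (Fin n → ℝ) → EuclideanSpace ℝ (Fin n)) := by fun_prop
  rw [e f hf, e g hg, e h hh]
  exact prekopa_leindler_pi (hf.comp hm) (hg.comp hm) (hh.comp hm) fun x y => by
    simpa using hfg (WithLp.toLp 2 x) (WithLp.toLp 2 y)

end

section

variable {n : ℕ}

/-! ### Densities of log-concave measures -/

/-- The density of a log-concave measure may be taken measurable. -/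
lemma IsLogConcave.exists_measurable_density {μ : Measure (EuclideanSpace ℝ (Fin n))} (hμ : IsLogConcave μ) :
    ∃ (K : Set (EuclideanSpace ℝ (Fin n))) (V : EuclideanSpace ℝ (Fin n) → ℝ),
      ConvexOn ℝ K V ∧ Measurable (K.indicator fun x => ENNReal.ofReal (Real.exp (-V x))) ∧
      μ = volume.withDensity (K.indicator fun x => ENNReal.ofReal (Real.exp (-V x))) := by
  obtain ⟨K, V, hV, rfl⟩ := hμ
  -- On the boundary of K, membership and V may be non-measurable, but that boundary is null, and V
  -- is continuous on the interior.
  have hV' : ConvexOn ℝ (interior K) V := hV.subset interior_subset hV.1.interior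
  refine ⟨interior K, V, hV', ?_, ?_⟩
  · have hc : ContinuousOn (fun x => ENNReal.ofReal (Real.exp (-V x))) (interior K) :=
      ENNReal.continuous_ofReal.comp_continuousOn
        (Real.continuous_exp.comp_continuousOn hV.continuousOn_interior.neg)
    classical
    rw [← Set.piecewise_eq_indicator]
    exact hc.measurable_piecewise continuousOn_const isOpen_interior.measurableSet
  · refine withDensity_congr_ae ?_
    have h0 : volume (frontier K) = 0 := hV.1.addHaar_frontier volume
    have h1 : interior K =ᵐ[volume] K := interior_ae_eq_of_null_frontier h0
    exact (indicator_ae_eq_of_ae_eq_set h1).symm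

lemma IsLogConcave.exists_density {μ : Measure (EuclideanSpace ℝ (Fin n))}
    (hμ : IsLogConcave μ) :
    ∃ ρ : EuclideanSpace ℝ (Fin n) → ℝ≥0∞, Measurable ρ ∧ μ = volume.withDensity ρ ∧
      ∀ x y, ρ x * ρ y ≤ ρ ((1 / 2 : ℝ) • (x + y)) ^ 2 := by
  obtain ⟨K, V, hV, hm, rfl⟩ := hμ.exists_measurable_density
  refine ⟨_, hm, rfl, fun x y => ?_⟩
  by_cases hx : x ∈ K
  swap; · simp [hx]
  by_cases hy : y ∈ K
  swap; · simp [hy]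
  have hz : (1 / 2 : ℝ) • (x + y) ∈ K := by
    rw [smul_add]
    exact hV.1 hx hy (by norm_num) (by norm_num) (by norm_num)
  have hle : V ((1 / 2 : ℝ) • (x + y)) ≤ 1 / 2 * V x + 1 / 2 * V y := by
    rw [smul_add]
    exact hV.2 hx hy (by norm_num) (by norm_num) (by norm_num)
  rw [Set.indicator_of_mem hx, Set.indicator_of_mem hy, Set.indicator_of_mem hz,
    ← ENNReal.ofReal_mul (Real.exp_nonneg _), ← ENNReal.ofReal_pow (Real.exp_nonneg _),
    ← Real.exp_add, ← Real.exp_nat_mul]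
  refine ENNReal.ofReal_le_ofReal (Real.exp_le_exp.2 ?_)
  push_cast
  linarith

/-! ### Moments and covariance -/

/-- A measure with all exponential moments. -/
def HasExpMoments (ν : Measure (EuclideanSpace ℝ (Fin n))) : Prop :=
  ∀ h : EuclideanSpace ℝ (Fin n), Integrable (fun x => Real.exp ⟪h, x⟫) ν

lemma HasExpMoments.integrable_exp_mul {ν : Measure (EuclideanSpace ℝ (Fin n))}
    (hν : HasExpMoments ν) (θ : EuclideanSpace ℝ (Fin n)) (t : ℝ) :
    Integrable (fun x => Real.exp (t * ⟪θ, x⟫)) ν := by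
  simpa [inner_smul_left] using hν (t • θ)

lemma HasExpMoments.integrableExpSet_eq {ν : Measure (EuclideanSpace ℝ (Fin n))}
    (hν : HasExpMoments ν) (θ : EuclideanSpace ℝ (Fin n)) :
    integrableExpSet (fun x => ⟪θ, x⟫) ν = Set.univ := by
  ext t
  simpa [integrableExpSet] using hν.integrable_exp_mul θ t

lemma HasExpMoments.memLp_inner {ν : Measure (EuclideanSpace ℝ (Fin n))}
    (hν : HasExpMoments ν) (θ : EuclideanSpace ℝ (Fin n)) (p : NNReal) :
    MemLp (fun x => ⟪θ, x⟫) p ν :=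
  memLp_of_mem_interior_integrableExpSet (by simp [hν.integrableExpSet_eq θ]) p

lemma HasExpMoments.memLp_id {ν : Measure (EuclideanSpace ℝ (Fin n))}
    (hν : HasExpMoments ν) (p : NNReal) : MemLp (fun x => x) p ν := by
  refine MemLp.of_eval_piLp fun i => ?_
  have := hν.memLp_inner (EuclideanSpace.basisFun (Fin n) ℝ i) p
  simpa [EuclideanSpace.inner_single_left] using this

/-- By Cauchy–Schwarz, a positive semidefinite form is controlled by its diagonal. -/
lemma norm_covarianceBilin_le {ν : Measure (EuclideanSpace ℝ (Fin n))} [IsFiniteMeasure ν]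
    (hν : MemLp id 2 ν) {c : ℝ} (hc : 0 ≤ c)
    (h : ∀ θ : EuclideanSpace ℝ (Fin n), Var[fun x => ⟪θ, x⟫; ν] ≤ c * ‖θ‖ ^ 2) :
    ‖covarianceBilin ν‖ ≤ c := by
  refine ContinuousLinearMap.opNorm_le_bound₂ _ hc fun x y => ?_
  have h1 : (covarianceBilin ν x y) ^ 2 ≤ covarianceBilin ν x x * covarianceBilin ν y y := by
    refine LinearMap.BilinForm.apply_sq_le_of_symm (covarianceBilin ν).toBilinForm
      (isPosSemidef_covarianceBilin (μ := ν)).nonneg ?_ x y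
    exact ⟨fun x y => covarianceBilin_comm x y⟩
  have hx := h x
  have hy := h y
  rw [← covarianceBilin_self hν] at hx hy
  refine abs_le_of_sq_le_sq ?_ (by positivity)
  calc (covarianceBilin ν x y) ^ 2 ≤ covarianceBilin ν x x * covarianceBilin ν y y := h1
    _ ≤ (c * ‖x‖ ^ 2) * (c * ‖y‖ ^ 2) :=
      mul_le_mul hx hy (covarianceBilin_self_nonneg y) (by positivity)
    _ = (c * ‖x‖ * ‖y‖) ^ 2 := by ring

lemma variance_inner_le {ν : Measure (EuclideanSpace ℝ (Fin n))} [IsFiniteMeasure ν]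
    (hν : MemLp id 2 ν) (θ : EuclideanSpace ℝ (Fin n)) :
    Var[fun x => ⟪θ, x⟫; ν] ≤ ‖covarianceBilin ν‖ * ‖θ‖ ^ 2 := by
  rw [← covarianceBilin_self hν]
  refine (le_abs_self _).trans (((covarianceBilin ν).le_opNorm₂ θ θ).trans_eq ?_)
  ring

/-- Jensen's inequality for the exponential. -/
lemma exp_integral_le {α : Type*} [MeasurableSpace α] {μ : Measure α} [IsProbabilityMeasure μ]
    {f : α → ℝ} (hf : Integrable f μ) (he : Integrable (fun x => Real.exp (f x)) μ) :
    Real.exp (∫ x, f x ∂μ) ≤ ∫ x, Real.exp (f x) ∂μ :=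
  convexOn_exp.map_integral_le Real.continuous_exp.continuousOn isClosed_univ (by simp) hf he

lemma one_add_sq_div_two_le_cosh (x : ℝ) : 1 + x ^ 2 / 2 ≤ Real.cosh x := by
  have := sum_le_hasSum (Finset.range 2) (fun i _ => by rw [pow_mul]; positivity)
    (Real.hasSum_cosh x)
  simpa [Finset.sum_range_succ] using this

/-- A variance bound from a bound on the product of two opposite exponential moments. -/
lemma sq_mul_variance_le {α : Type*} [MeasurableSpace α] {μ : Measure α} [IsProbabilityMeasure μ]
    {X : α → ℝ} (hX : MemLp X 2 μ) {δ M : ℝ}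
    (h1 : Integrable (fun x => Real.exp (δ * X x)) μ)
    (h2 : Integrable (fun x => Real.exp (-δ * X x)) μ)
    (hM : (∫ x, Real.exp (δ * X x) ∂μ) * ∫ x, Real.exp (-δ * X x) ∂μ ≤ M) :
    δ ^ 2 * Var[X; μ] ≤ M - 1 := by
  have hXi : Integrable X μ := hX.integrable (by norm_num)
  set b := ∫ x, X x ∂μ
  have e1 : ∀ ε x, Real.exp (ε * (X x - b)) = Real.exp (-ε * b) * Real.exp (ε * X x) :=
    fun ε x => by rw [← Real.exp_add]; ring_nf
  have i1 : Integrable (fun x => Real.exp (δ * (X x - b))) μ := by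
    simp only [e1]; exact h1.const_mul _
  have i2 : Integrable (fun x => Real.exp (-δ * (X x - b))) μ := by
    simp only [e1]; exact h2.const_mul _
  have hXb : Integrable (fun x => X x - b) μ := hXi.sub (integrable_const b)
  have hb : ∫ x, (X x - b) ∂μ = 0 := by
    rw [integral_sub hXi (integrable_const b)]; simp [b]
  have u1 : 1 ≤ ∫ x, Real.exp (δ * (X x - b)) ∂μ := by
    have := exp_integral_le (hXb.const_mul δ) i1
    rwa [integral_const_mul, hb, mul_zero, Real.exp_zero] at this
  have u2 : 1 ≤ ∫ x, Real.exp (-δ * (X x - b)) ∂μ := by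
    have := exp_integral_le (hXb.const_mul (-δ)) i2
    rwa [integral_const_mul, hb, mul_zero, Real.exp_zero] at this
  have hprod : (∫ x, Real.exp (δ * (X x - b)) ∂μ) * ∫ x, Real.exp (-δ * (X x - b)) ∂μ ≤ M := by
    simp only [e1]
    rw [integral_const_mul, integral_const_mul]
    refine le_of_eq_of_le ?_ hM
    rw [mul_mul_mul_comm, ← Real.exp_add]
    simp
  have hsq : Integrable (fun x => (X x - b) ^ 2) μ := (hX.sub (memLp_const b)).integrable_sq
  have hlow : 2 + δ ^ 2 * Var[X; μ] ≤
      (∫ x, Real.exp (δ * (X x - b)) ∂μ) + ∫ x, Real.exp (-δ * (X x - b)) ∂μ := by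
    rw [variance_eq_integral hX.1.aemeasurable, ← integral_add i1 i2, ← integral_const_mul]
    have : (2 : ℝ) = ∫ _x, (2 : ℝ) ∂μ := by simp
    nth_rw 1 [this]
    rw [← integral_add (integrable_const _) (hsq.const_mul _)]
    refine integral_mono ((integrable_const _).add (hsq.const_mul _)) (i1.add i2) fun x => ?_
    have := one_add_sq_div_two_le_cosh (δ * (X x - b))
    rw [Real.cosh_eq] at this
    simp only [neg_mul]
    nlinarith
  -- Both factors are at least 1, so (u - 1)(v - 1) ≥ 0 gives u + v ≤ 1 + uv ≤ 1 + M.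
  nlinarith

/-! ### Strongly log-concave measures -/

/-- Midpoint convexity of t|x|² has the quantitative gain t|x - y|²/2, from the parallelogram law.
It pays for the mismatch ⟨θ, x - y⟩ of the two tilts up to |θ|²/(2t), after which Prékopa–Leindler
applies. -/
lemma mul_lintegral_exp_le {μ : Measure (EuclideanSpace ℝ (Fin n))} (hμ : IsLogConcave μ)
    {t : ℝ} (ht : 0 < t) (h θ : EuclideanSpace ℝ (Fin n)) :
    (∫⁻ x, ENNReal.ofReal (Real.exp (-t * ‖x‖ ^ 2 + ⟪h + θ, x⟫)) ∂μ) *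
        ∫⁻ x, ENNReal.ofReal (Real.exp (-t * ‖x‖ ^ 2 + ⟪h - θ, x⟫)) ∂μ ≤
      ENNReal.ofReal (Real.exp (‖θ‖ ^ 2 / (2 * t))) *
        (∫⁻ x, ENNReal.ofReal (Real.exp (-t * ‖x‖ ^ 2 + ⟪h, x⟫)) ∂μ) ^ 2 := by
  obtain ⟨ρ, hρ, rfl, hρ2⟩ := hμ.exists_density
  have hm : ∀ w : EuclideanSpace ℝ (Fin n), Measurable
      fun x : EuclideanSpace ℝ (Fin n) => ENNReal.ofReal (Real.exp (-t * ‖x‖ ^ 2 + ⟪w, x⟫)) :=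
    fun w => by fun_prop
  simp only [lintegral_withDensity_eq_lintegral_mul _ hρ (hm _)]
  have e : ENNReal.ofReal (Real.exp (‖θ‖ ^ 2 / (2 * t))) =
      ENNReal.ofReal (Real.exp (‖θ‖ ^ 2 / (4 * t))) ^ 2 := by
    rw [← ENNReal.ofReal_pow (Real.exp_nonneg _), ← Real.exp_nat_mul]
    congr 2
    push_cast
    field_simp
    norm_num
  rw [e, ← mul_pow, ← lintegral_const_mul _ (hρ.mul (hm h))]
  refine prekopa_leindler (hρ.mul (hm _)) (hρ.mul (hm _)) ((hρ.mul (hm _)).const_mul _)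
    fun x y => ?_
  set z := (1 / 2 : ℝ) • (x + y)
  simp only [Pi.mul_apply]
  have key : (-t * ‖x‖ ^ 2 + ⟪h + θ, x⟫) + (-t * ‖y‖ ^ 2 + ⟪h - θ, y⟫) ≤
      2 * (‖θ‖ ^ 2 / (4 * t)) + 2 * (-t * ‖z‖ ^ 2 + ⟪h, z⟫) := by
    have h1 : ⟪h, z⟫ = 1 / 2 * (⟪h, x⟫ + ⟪h, y⟫) := by
      simp [z, inner_smul_right, inner_add_right, mul_add]
    have h2 : ‖z‖ ^ 2 = 1 / 4 * ‖x + y‖ ^ 2 := by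
      simp only [z, norm_smul, mul_pow]; norm_num
    have h3 := parallelogram_law_with_norm ℝ x y
    have h4 : 0 ≤ ‖(x - y) - (1 / t) • θ‖ ^ 2 := by positivity
    rw [norm_sub_sq_real, inner_smul_right, norm_smul, mul_pow, inner_sub_left,
      real_inner_comm, real_inner_comm θ y] at h4
    rw [inner_add_left, inner_sub_left, h1, h2]
    have h5 : 0 ≤ t / 2 * (‖x - y‖ ^ 2 - 2 * (1 / t * (⟪θ, x⟫ - ⟪θ, y⟫)) +
      ‖(1 / t : ℝ)‖ ^ 2 * ‖θ‖ ^ 2) := by positivity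
    have h6 : t / 2 * (‖x - y‖ ^ 2 - 2 * (1 / t * (⟪θ, x⟫ - ⟪θ, y⟫)) +
      ‖(1 / t : ℝ)‖ ^ 2 * ‖θ‖ ^ 2) = t / 2 * ‖x - y‖ ^ 2 - (⟪θ, x⟫ - ⟪θ, y⟫) +
        2 * (‖θ‖ ^ 2 / (4 * t)) := by
      rw [Real.norm_eq_abs, sq_abs]
      field_simp
      ring
    rw [h6] at h5
    nlinarith
  calc ρ x * ENNReal.ofReal (Real.exp (-t * ‖x‖ ^ 2 + ⟪h + θ, x⟫)) *
        (ρ y * ENNReal.ofReal (Real.exp (-t * ‖y‖ ^ 2 + ⟪h - θ, y⟫)))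
      = ρ x * ρ y * ENNReal.ofReal (Real.exp ((-t * ‖x‖ ^ 2 + ⟪h + θ, x⟫) +
          (-t * ‖y‖ ^ 2 + ⟪h - θ, y⟫))) := by
        rw [Real.exp_add (_ + _) (_ + _), ENNReal.ofReal_mul (Real.exp_nonneg _)]; ring
    _ ≤ ρ z ^ 2 * ENNReal.ofReal (Real.exp (2 * (‖θ‖ ^ 2 / (4 * t)) +
          2 * (-t * ‖z‖ ^ 2 + ⟪h, z⟫))) := by
        gcongr
        exact hρ2 x y
    _ = _ := by
        rw [Real.exp_add, ENNReal.ofReal_mul (Real.exp_nonneg _), two_mul, two_mul, Real.exp_add,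
          Real.exp_add, ENNReal.ofReal_mul (Real.exp_nonneg _),
          ENNReal.ofReal_mul (Real.exp_nonneg _)]
        ring

/-- Gaussian tilts of a log-concave measure have covariance at most `1 / t`. -/
theorem norm_covarianceBilin_tilted_le {μ : Measure (EuclideanSpace ℝ (Fin n))}
    (hμ : IsLogConcave μ) (hμ0 : μ ≠ 0) {t : ℝ} (ht : 0 < t)
    (hint : ∀ h : EuclideanSpace ℝ (Fin n),
      Integrable (fun x => Real.exp (-t * ‖x‖ ^ 2 + ⟪h, x⟫)) μ)
    (h : EuclideanSpace ℝ (Fin n)) :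
    ‖covarianceBilin (μ.tilted fun x => -t * ‖x‖ ^ 2 + ⟪h, x⟫)‖ ≤ 1 / t := by
  have : NeZero μ := ⟨hμ0⟩
  set ν := μ.tilted fun x => -t * ‖x‖ ^ 2 + ⟪h, x⟫ with hν
  have hprob : IsProbabilityMeasure ν := isProbabilityMeasure_tilted (hint h)
  have hexp : HasExpMoments ν := fun w => by
    rw [hν, integrable_tilted_iff (hint h)]
    refine (hint (h + w)).congr (Filter.Eventually.of_forall fun x => ?_)
    simp only [smul_eq_mul, ← Real.exp_add, inner_add_left, add_assoc]
  refine norm_covarianceBilin_le (hexp.memLp_id 2) (by positivity) fun θ => ?_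
  rcases eq_or_ne θ 0 with rfl | hθ
  · have : (fun x : EuclideanSpace ℝ (Fin n) => ⟪(0 : EuclideanSpace ℝ (Fin n)), x⟫) = 0 := by
      ext; simp
    rw [this, variance_zero]
    simp
  have hθ' : 0 < ‖θ‖ ^ 2 := by positivity
  have hlin : ∀ w : EuclideanSpace ℝ (Fin n), ∫ x, Real.exp ⟪w, x⟫ ∂ν =
      (∫ x, Real.exp (-t * ‖x‖ ^ 2 + ⟪h + w, x⟫) ∂μ) /
        ∫ x, Real.exp (-t * ‖x‖ ^ 2 + ⟪h, x⟫) ∂μ := fun w => by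
    rw [hν, integral_exp_tilted]
    simp only [Pi.add_apply, inner_add_left, add_assoc]
  have hZ : 0 < ∫ x, Real.exp (-t * ‖x‖ ^ 2 + ⟪h, x⟫) ∂μ := integral_exp_pos (hint h)
  have hM : ∀ δ : ℝ, (∫ x, Real.exp (δ * ⟪θ, x⟫) ∂ν) * ∫ x, Real.exp (-δ * ⟪θ, x⟫) ∂ν ≤
      Real.exp (δ ^ 2 * ‖θ‖ ^ 2 / (2 * t)) := by
    intro δ
    have e1 : ∀ ε : ℝ, ∫ x, Real.exp (ε * ⟪θ, x⟫) ∂ν = ∫ x, Real.exp ⟪ε • θ, x⟫ ∂ν := fun ε => by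
      simp [inner_smul_left]
    rw [e1, e1, hlin, hlin, div_mul_div_comm, div_le_iff₀ (by positivity)]
    have hpl := mul_lintegral_exp_le hμ ht h (δ • θ)
    rw [← ofReal_integral_eq_lintegral_ofReal (hint _) (ae_of_all _ fun _ => Real.exp_nonneg _),
      ← ofReal_integral_eq_lintegral_ofReal (hint _) (ae_of_all _ fun _ => Real.exp_nonneg _),
      ← ofReal_integral_eq_lintegral_ofReal (hint _) (ae_of_all _ fun _ => Real.exp_nonneg _),
      ← ENNReal.ofReal_mul (by positivity), ← ENNReal.ofReal_pow (by positivity),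
      ← ENNReal.ofReal_mul (by positivity), ENNReal.ofReal_le_ofReal_iff (by positivity)] at hpl
    rw [norm_smul, mul_pow, Real.norm_eq_abs, sq_abs] at hpl
    rw [← sq, neg_smul, ← sub_eq_add_neg]
    exact hpl
  -- This scale makes the moment product at most e; then e - 1 ≤ 2 gives the variance bound |θ|²/t.
  set δ : ℝ := Real.sqrt (2 * t) / ‖θ‖
  have hδ : δ ^ 2 * ‖θ‖ ^ 2 = 2 * t := by
    rw [div_pow, Real.sq_sqrt (by positivity)]
    field_simp
  have hv := sq_mul_variance_le (hexp.memLp_inner θ 2) (hexp.integrable_exp_mul θ δ)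
    (hexp.integrable_exp_mul θ (-δ)) (hM δ)
  rw [hδ, div_self (by positivity)] at hv
  have he := Real.exp_one_lt_d9
  have hv2 : δ ^ 2 * Var[fun x => ⟪θ, x⟫; ν] ≤ 2 := by linarith
  have : 2 * t * Var[fun x => ⟪θ, x⟫; ν] ≤ 2 * ‖θ‖ ^ 2 := by
    rw [← hδ]; nlinarith
  rw [one_div_mul_eq_div, le_div_iff₀ ht]
  linarith

end

section

variable {n : ℕ}

/-! ### Tilts and tilt-stable measures -/

lemma tilted_add_const {α : Type*} [MeasurableSpace α] (μ : Measure α) (f : α → ℝ) (c : ℝ) :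
    (μ.tilted fun x => f x + c) = μ.tilted f := by
  simp only [Measure.tilted, Real.exp_add, integral_mul_const]
  congr 1
  ext x
  rw [mul_div_mul_right _ _ (Real.exp_pos c).ne']

variable {μ ν : Measure (EuclideanSpace ℝ (Fin n))} {β : ℝ}

lemma IsTiltStable.hasExpMoments (hμ : IsTiltStable β μ) : HasExpMoments μ :=
  fun h => (hμ.2 h).1.1

lemma IsTiltStable.ne_zero (hμ : IsTiltStable β μ) : μ ≠ 0 := by
  rintro rfl
  simpa using (hμ.2 0).1.2

lemma IsTiltStable.isProbabilityMeasure_tilted (hμ : IsTiltStable β μ)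
    (h : EuclideanSpace ℝ (Fin n)) : IsProbabilityMeasure (μ.tilted fun x => ⟪h, x⟫) :=
  have : NeZero μ := ⟨hμ.ne_zero⟩
  MeasureTheory.isProbabilityMeasure_tilted (hμ.hasExpMoments h)

lemma HasExpMoments.tilted (hμ : HasExpMoments μ) (h : EuclideanSpace ℝ (Fin n)) :
    HasExpMoments (μ.tilted fun x => ⟪h, x⟫) := fun w => by
  rw [integrable_tilted_iff (hμ h)]
  refine (hμ (h + w)).congr (Filter.Eventually.of_forall fun x => ?_)
  simp only [smul_eq_mul, ← Real.exp_add, inner_add_left]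

lemma tilted_inner_tilted_inner (hμ : HasExpMoments μ) (h w : EuclideanSpace ℝ (Fin n)) :
    ((μ.tilted fun x => ⟪h, x⟫).tilted fun x => ⟪w, x⟫) = μ.tilted fun x => ⟪h + w, x⟫ := by
  rw [tilted_tilted (hμ h)]
  congr 1
  ext x
  simp [inner_add_left]

lemma IsTiltStable.tilted (hμ : IsTiltStable β μ) (h : EuclideanSpace ℝ (Fin n)) :
    IsTiltStable β (μ.tilted fun x => ⟪h, x⟫) := by
  have := hμ.isProbabilityMeasure_tilted h
  refine ⟨hμ.1, fun w => ⟨⟨hμ.hasExpMoments.tilted h w,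
    integral_exp_pos (hμ.hasExpMoments.tilted h w)⟩, ?_⟩⟩
  rw [tilted_inner_tilted_inner hμ.hasExpMoments]
  exact (hμ.2 (h + w)).2

lemma HasExpMoments.integrable_id [IsFiniteMeasure ν] (hν : HasExpMoments ν) :
    Integrable (fun x => x) ν :=
  (hν.memLp_id 1).integrable le_rfl

lemma HasExpMoments.integral_inner [IsFiniteMeasure ν] (hν : HasExpMoments ν)
    (θ : EuclideanSpace ℝ (Fin n)) : ∫ x, ⟪θ, x⟫ ∂ν = ⟪θ, ∫ x, x ∂ν⟫ :=
  _root_.integral_inner hν.integrable_id θ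

lemma IsTiltStable.variance_tilted_le (hν : IsTiltStable 1 ν) (h θ : EuclideanSpace ℝ (Fin n)) :
    Var[fun x => ⟪θ, x⟫; ν.tilted fun x => ⟪h, x⟫] ≤ ‖θ‖ ^ 2 := by
  have := hν.isProbabilityMeasure_tilted h
  refine (variance_inner_le ((hν.hasExpMoments.tilted h).memLp_id 2) θ).trans ?_
  have h2 := (hν.2 h).2
  rw [one_pow] at h2
  exact mul_le_of_le_one_left (by positivity) h2

lemma IsTiltStable.variance_le [IsProbabilityMeasure ν] (hν : IsTiltStable 1 ν)
    (θ : EuclideanSpace ℝ (Fin n)) : Var[fun x => ⟪θ, x⟫; ν] ≤ ‖θ‖ ^ 2 := by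
  have := hν.variance_tilted_le 0 θ
  simpa using this

/-- Tilt-stable measures are sub-Gaussian. -/
lemma IsTiltStable.integral_exp_le [IsProbabilityMeasure ν] (hν : IsTiltStable 1 ν)
    (θ : EuclideanSpace ℝ (Fin n)) :
    ∫ x, Real.exp ⟪θ, x - ∫ y, y ∂ν⟫ ∂ν ≤ Real.exp (‖θ‖ ^ 2 / 2) := by
  set b := ∫ y, y ∂ν
  have hE := hν.hasExpMoments
  set X : EuclideanSpace ℝ (Fin n) → ℝ := fun x => ⟪θ, x - b⟫ with hX
  have hXe : X = fun x => ⟪θ, x⟫ + -⟪θ, b⟫ := by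
    ext x; rw [hX, ← sub_eq_add_neg, ← inner_sub_right]
  have hi : ∀ u : ℝ, Integrable (fun x => Real.exp (u * X x)) ν := fun u => by
    simp only [hXe, mul_add, Real.exp_add]
    exact (hE.integrable_exp_mul θ u).mul_const _
  have hc : ν[X] = 0 := by
    rw [hXe, integral_add ((hE.memLp_inner θ 1).integrable le_rfl) (integrable_const _),
      hE.integral_inner]
    simp [b]
  have hs : Set.Icc 0 (1 : ℝ) ⊆ interior (integrableExpSet X ν) := by simp [hi, integrableExpSet]
  -- Second-order Taylor expansion of the log-Laplace transform: its second derivative is the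
  -- variance under a linear tilt, which tilt-stability bounds.
  obtain ⟨u, h1, h2⟩ := exists_cgf_eq_iteratedDeriv_two_cgf_mul one_pos hc hs
  have h3 : ∫ x, Real.exp (X x) ∂ν = Real.exp (cgf X ν 1) := by
    rw [exp_cgf (hi 1)]; simp [mgf]
  rw [h3, Real.exp_le_exp, h2, ← variance_tilted_mul (hs (Set.mem_Icc_of_Ioo h1))]
  have h4 : (ν.tilted fun x => u * X x) = ν.tilted fun x => ⟪u • θ, x⟫ := by
    simp only [hXe, mul_add, tilted_add_const, inner_smul_left]
    simp
  have := hν.isProbabilityMeasure_tilted (u • θ)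
  rw [h4, hXe, variance_add_const
    ((hE.tilted (u • θ)).memLp_inner θ 1).aestronglyMeasurable]
  have := hν.variance_tilted_le (u • θ) θ
  linarith

/-- Linearizes a square in the exponent: averaging e^{uy} over a Gaussian u reduces moments of
e^{y²/4} to linear exponential moments. -/
lemma lintegral_exp_neg_sq_add (y : ℝ) :
    ∫⁻ u : ℝ, ENNReal.ofReal (Real.exp (-u ^ 2 + u * y)) =
      ENNReal.ofReal (Real.sqrt Real.pi * Real.exp (y ^ 2 / 4)) := by
  have h1 : ∫⁻ u : ℝ, ENNReal.ofReal (Real.exp (-(u - y / 2) ^ 2)) =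
      ENNReal.ofReal (Real.sqrt Real.pi) := by
    rw [lintegral_sub_right_eq_self (fun u : ℝ => ENNReal.ofReal (Real.exp (-u ^ 2))) (y / 2),
      ← ofReal_integral_eq_lintegral_ofReal]
    · have := integral_gaussian 1
      simp only [neg_mul, one_mul, div_one] at this
      rw [this]
    · simpa using integrable_exp_neg_mul_sq one_pos
    · exact ae_of_all _ fun _ => Real.exp_nonneg _
  rw [mul_comm, ENNReal.ofReal_mul (Real.exp_nonneg _), ← h1, ← lintegral_const_mul _ (by fun_prop)]
  refine lintegral_congr fun u => ?_
  rw [← ENNReal.ofReal_mul (Real.exp_nonneg _), ← Real.exp_add]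
  ring_nf

/-- Squares of marginals of tilt-stable measures have an exponential moment. -/
lemma IsTiltStable.lintegral_exp_sq_le [IsProbabilityMeasure ν] (hν : IsTiltStable 1 ν)
    {θ : EuclideanSpace ℝ (Fin n)} (hθ : ‖θ‖ ≤ 1) :
    ∫⁻ x, ENNReal.ofReal (Real.exp (⟪θ, x - ∫ y, y ∂ν⟫ ^ 2 / 4)) ∂ν ≤ 2 := by
  set b := ∫ y, y ∂ν
  have hpi : 0 < Real.sqrt Real.pi := Real.sqrt_pos.2 Real.pi_pos
  have key : ENNReal.ofReal (Real.sqrt Real.pi) *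
      ∫⁻ x, ENNReal.ofReal (Real.exp (⟪θ, x - b⟫ ^ 2 / 4)) ∂ν ≤
        ENNReal.ofReal (Real.sqrt Real.pi) * 2 := by
    rw [← lintegral_const_mul _ (by fun_prop)]
    simp only [← ENNReal.ofReal_mul hpi.le, ← lintegral_exp_neg_sq_add]
    rw [lintegral_lintegral_swap (by fun_prop)]
    calc ∫⁻ u : ℝ, ∫⁻ x, ENNReal.ofReal (Real.exp (-u ^ 2 + u * ⟪θ, x - b⟫)) ∂ν
        ≤ ∫⁻ u : ℝ, ENNReal.ofReal (Real.exp (-(1 / 2) * u ^ 2)) := by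
          refine lintegral_mono fun u => ?_
          have hint : Integrable (fun x => Real.exp ⟪u • θ, x - b⟫) ν := by
            simp only [inner_sub_right, Real.exp_sub]
            exact (hν.hasExpMoments _).div_const _
          have h1 := hν.integral_exp_le (u • θ)
          have e : ∀ x, ENNReal.ofReal (Real.exp (-u ^ 2 + u * ⟪θ, x - b⟫)) =
              ENNReal.ofReal (Real.exp (-u ^ 2)) * ENNReal.ofReal (Real.exp ⟪u • θ, x - b⟫) := by
            intro x
            rw [← ENNReal.ofReal_mul (Real.exp_nonneg _), ← Real.exp_add]
            simp [inner_smul_left]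
          simp only [e]
          rw [lintegral_const_mul _ (by fun_prop), ← ofReal_integral_eq_lintegral_ofReal hint
            (ae_of_all _ fun _ => Real.exp_nonneg _), ← ENNReal.ofReal_mul (Real.exp_nonneg _)]
          refine ENNReal.ofReal_le_ofReal ?_
          refine (mul_le_mul_of_nonneg_left h1 (Real.exp_nonneg _)).trans ?_
          rw [← Real.exp_add, Real.exp_le_exp, norm_smul, mul_pow, Real.norm_eq_abs, sq_abs]
          have : ‖θ‖ ^ 2 ≤ 1 := pow_le_one₀ (norm_nonneg _) hθ
          nlinarith [sq_nonneg u]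
      _ = ENNReal.ofReal (Real.sqrt (Real.pi / (1 / 2))) := by
          rw [← integral_gaussian, ofReal_integral_eq_lintegral_ofReal
            (integrable_exp_neg_mul_sq (by norm_num)) (ae_of_all _ fun _ => Real.exp_nonneg _)]
      _ ≤ ENNReal.ofReal (Real.sqrt Real.pi * 2) := by
          refine ENNReal.ofReal_le_ofReal ?_
          rw [Real.sqrt_le_left (by positivity), mul_pow, Real.sq_sqrt Real.pi_pos.le]
          nlinarith [Real.pi_pos]
      _ = ENNReal.ofReal (Real.sqrt Real.pi) * 2 := by
          rw [ENNReal.ofReal_mul hpi.le]; simp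
  exact (ENNReal.mul_le_mul_iff_right (by simpa using hpi) ENNReal.ofReal_ne_top).1 key

lemma HasExpMoments.integrable_norm_sub_sq [IsFiniteMeasure ν] (hν : HasExpMoments ν)
    (b : EuclideanSpace ℝ (Fin n)) : Integrable (fun x => ‖x - b‖ ^ 2) ν :=
  ((hν.memLp_id 2).sub (memLp_const b)).integrable_norm_pow (by norm_num)

/-- The total variance of a tilt-stable measure is at most the dimension. -/
lemma IsTiltStable.integral_norm_sub_sq_le [IsProbabilityMeasure ν] (hν : IsTiltStable 1 ν) :
    ∫ x, ‖x - ∫ y, y ∂ν‖ ^ 2 ∂ν ≤ n := by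
  set b := ∫ y, y ∂ν with hb
  have hE := hν.hasExpMoments
  have hi : ∀ i : Fin n, ∀ x : EuclideanSpace ℝ (Fin n),
      x i = ⟪EuclideanSpace.single i (1 : ℝ), x⟫ := fun i x => by
    simp [EuclideanSpace.inner_single_left]
  have hv : ∀ i : Fin n, Var[fun x => ⟪EuclideanSpace.single i (1 : ℝ), x⟫; ν] =
      ∫ x, (x i - b i) ^ 2 ∂ν := fun i => by
    rw [variance_eq_integral (hE.memLp_inner _ 1).aestronglyMeasurable.aemeasurable,
      hE.integral_inner]
    simp only [hi i]
    rfl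
  have hint : ∀ i : Fin n, Integrable (fun x => (x i - b i) ^ 2) ν := fun i => by
    simp only [hi i]
    exact ((hE.memLp_inner _ 2).sub (memLp_const _)).integrable_sq
  have e : ∀ x : EuclideanSpace ℝ (Fin n), ‖x - b‖ ^ 2 = ∑ i, (x i - b i) ^ 2 := fun x => by
    rw [EuclideanSpace.norm_sq_eq]; simp
  simp only [e]
  rw [integral_finsetSum _ fun i _ => hint i]
  calc ∑ i : Fin n, ∫ x, (x i - b i) ^ 2 ∂ν ≤ ∑ _i : Fin n, (1 : ℝ) := by
        refine Finset.sum_le_sum fun i _ => ?_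
        rw [← hv]
        simpa using hν.variance_le (EuclideanSpace.single i (1 : ℝ))
    _ = n := by simp

/-! ### Finiteness of `tildeK` -/

/-- |x - b|²/(4n) is the average over coordinates of (x_i - b_i)²/4, so convexity of exp reduces to
the marginals. -/
lemma IsTiltStable.lintegral_exp_norm_sq_le [IsProbabilityMeasure ν] (hν : IsTiltStable 1 ν)
    (hn : 1 ≤ n) :
    ∫⁻ x, ENNReal.ofReal (Real.exp (‖x - ∫ y, y ∂ν‖ ^ 2 / (4 * n))) ∂ν ≤ 2 := by
  set b := ∫ y, y ∂ν
  have hn0 : (0 : ℝ) < n := by exact_mod_cast hn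
  have hp : ∀ x : EuclideanSpace ℝ (Fin n), Real.exp (‖x - b‖ ^ 2 / (4 * n)) ≤
      ∑ i : Fin n, (1 / n : ℝ) *
        Real.exp (⟪EuclideanSpace.single i (1 : ℝ), x - b⟫ ^ 2 / 4) := fun x => by
    have := convexOn_exp.map_sum_le (t := Finset.univ) (w := fun _ : Fin n => (1 / n : ℝ))
      (p := fun i => ⟪EuclideanSpace.single i (1 : ℝ), x - b⟫ ^ 2 / 4)
      (fun _ _ => by positivity) (by simp [hn0.ne']) (by simp)
    simp only [smul_eq_mul] at this
    refine le_of_eq_of_le ?_ this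
    rw [← Finset.mul_sum, ← Finset.sum_div, EuclideanSpace.norm_sq_eq]
    simp only [EuclideanSpace.inner_single_left]
    congr 1
    simp
    field_simp
  calc ∫⁻ x, ENNReal.ofReal (Real.exp (‖x - b‖ ^ 2 / (4 * n))) ∂ν
      ≤ ∫⁻ x, ∑ i : Fin n, ENNReal.ofReal (1 / n) * ENNReal.ofReal
          (Real.exp (⟪EuclideanSpace.single i (1 : ℝ), x - b⟫ ^ 2 / 4)) ∂ν := by
        refine lintegral_mono fun x => (ENNReal.ofReal_le_ofReal (hp x)).trans ?_
        rw [ENNReal.ofReal_sum_of_nonneg fun i _ => by positivity]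
        simp only [ENNReal.ofReal_mul (show (0 : ℝ) ≤ 1 / n by positivity)]
        exact le_rfl
    _ = ∑ i : Fin n, ENNReal.ofReal (1 / n) * ∫⁻ x, ENNReal.ofReal
          (Real.exp (⟪EuclideanSpace.single i (1 : ℝ), x - b⟫ ^ 2 / 4)) ∂ν := by
        rw [lintegral_finsetSum _ fun i _ => by fun_prop]
        refine Finset.sum_congr rfl fun i _ => lintegral_const_mul _ (by fun_prop)
    _ ≤ ∑ _i : Fin n, ENNReal.ofReal (1 / n) * 2 := by
        refine Finset.sum_le_sum fun i _ => mul_le_mul_right (hν.lintegral_exp_sq_le ?_) _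
        simp
    _ = 2 := by
        rw [Finset.sum_const, Finset.card_univ, Fintype.card_fin, nsmul_eq_mul, ← mul_assoc,
          ← ENNReal.ofReal_natCast, ← ENNReal.ofReal_mul hn0.le, mul_one_div_cancel hn0.ne']
        simp

/-- Shrinking the exponent by 4 leaves room below 2 for the additional constant factor in the Ψ₂
estimate. -/
lemma four_mul_exp_div_four_le (z : ℝ) : 4 * Real.exp (z / 4) ≤ 3 + Real.exp z := by
  have h : Real.exp z = Real.exp (z / 4) ^ 4 := by
    rw [← Real.exp_nat_mul]; congr 1; push_cast; ring
  rw [h]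
  nlinarith [sq_nonneg (Real.exp (z / 4) ^ 2 - 1), sq_nonneg (Real.exp (z / 4) - 1)]

lemma psiTwoNorm_le {f : EuclideanSpace ℝ (Fin n) → ℝ} {s : ℝ} (hs : 0 < s)
    (h : ∫⁻ x, ENNReal.ofReal (Real.exp (f x ^ 2 / s ^ 2)) ∂ν ≤ 2) :
    psiTwoNorm ν f ≤ ENNReal.ofReal s :=
  iInf_le_of_le s (iInf_le_of_le hs (iInf_le_of_le h le_rfl))

lemma IsTiltStable.psiTwoNorm_norm_le [IsProbabilityMeasure ν] (hν : IsTiltStable 1 ν)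
    (hn : 1 ≤ n) :
    psiTwoNorm ν (fun x => ‖x‖ - ∫ y, ‖y‖ ∂ν) ≤ ENNReal.ofReal (Real.sqrt (32 * n)) := by
  have hn0 : (0 : ℝ) < n := by exact_mod_cast hn
  have hE := hν.hasExpMoments
  refine psiTwoNorm_le (by positivity) ?_
  set b := ∫ y, y ∂ν with hb
  have hY : Integrable (fun x => ‖x - b‖) ν := (hE.integrable_id.sub (integrable_const b)).norm
  have hm2 : (∫ x, ‖x - b‖ ∂ν) ^ 2 ≤ n := by
    refine le_trans ?_ hν.integral_norm_sub_sq_le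
    have hL : MemLp (fun x => ‖x - b‖) 2 ν := ((hE.memLp_id 2).sub (memLp_const b)).norm
    have := variance_nonneg (fun x => ‖x - b‖) ν
    rw [variance_eq_sub hL] at this
    simpa using this
  have hbm : ‖b‖ ≤ ∫ y, ‖y‖ ∂ν := norm_integral_le_integral_norm _
  have hmb : ∫ y, ‖y‖ ∂ν ≤ ‖b‖ + ∫ x, ‖x - b‖ ∂ν := by
    have : ‖b‖ + ∫ x, ‖x - b‖ ∂ν = ∫ x, (‖b‖ + ‖x - b‖) ∂ν := by
      rw [integral_add (integrable_const _) hY]; simp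
    rw [this]
    refine integral_mono hE.integrable_id.norm ((integrable_const _).add hY) fun x => ?_
    have := norm_add_le b (x - b)
    simpa using this
  have hm0 : 0 ≤ ∫ x, ‖x - b‖ ∂ν := integral_nonneg fun _ => norm_nonneg _
  have hp : ∀ x : EuclideanSpace ℝ (Fin n),
      Real.exp ((‖x‖ - ∫ y, ‖y‖ ∂ν) ^ 2 / Real.sqrt (32 * n) ^ 2) ≤
        9 / 10 + 3 / 10 * Real.exp (‖x - b‖ ^ 2 / (4 * n)) := fun x => by
    have h1 : (‖x‖ - ∫ y, ‖y‖ ∂ν) ^ 2 ≤ (‖x - b‖ + ∫ x, ‖x - b‖ ∂ν) ^ 2 := by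
      refine sq_le_sq' ?_ ?_
      · have := norm_sub_norm_le b x
        rw [norm_sub_rev] at this
        linarith
      · have := norm_sub_norm_le x b
        linarith
    -- Here (u + v)² ≤ 2u² + 2v² with v² ≤ n; dividing by 32n leaves a quarter of |x - b|²/(4n),
    -- plus 1/16.
    have h2 : (‖x‖ - ∫ y, ‖y‖ ∂ν) ^ 2 / Real.sqrt (32 * n) ^ 2 ≤
        (‖x - b‖ ^ 2 / (4 * n)) / 4 + 1 / 16 := by
      rw [Real.sq_sqrt (by positivity), div_le_iff₀ (by positivity)]
      have : (‖x - b‖ ^ 2 / (4 * n) / 4 + 1 / 16) * (32 * (n : ℝ)) =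
        2 * ‖x - b‖ ^ 2 + 2 * n := by field_simp; ring
      rw [this]
      nlinarith [sq_nonneg (‖x - b‖ - ∫ x, ‖x - b‖ ∂ν)]
    have h3 := four_mul_exp_div_four_le (‖x - b‖ ^ 2 / (4 * n))
    have h4 : Real.exp (1 / 16) ≤ 6 / 5 := by
      have := Real.exp_bound' (x := 1 / 16) (by norm_num) (by norm_num) (n := 2) (by norm_num)
      norm_num [Finset.sum_range_succ] at this
      linarith
    calc _ ≤ Real.exp ((‖x - b‖ ^ 2 / (4 * n)) / 4 + 1 / 16) := Real.exp_le_exp.2 h2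
      _ = Real.exp ((‖x - b‖ ^ 2 / (4 * n)) / 4) * Real.exp (1 / 16) := Real.exp_add _ _
      _ ≤ ((3 + Real.exp (‖x - b‖ ^ 2 / (4 * n))) / 4) * (6 / 5) := by
          gcongr
          linarith
      _ = _ := by ring
  calc ∫⁻ x, ENNReal.ofReal (Real.exp ((‖x‖ - ∫ y, ‖y‖ ∂ν) ^ 2 / Real.sqrt (32 * n) ^ 2)) ∂ν
      ≤ ∫⁻ x, (ENNReal.ofReal (9 / 10) + ENNReal.ofReal (3 / 10) *
          ENNReal.ofReal (Real.exp (‖x - b‖ ^ 2 / (4 * n)))) ∂ν := by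
        refine lintegral_mono fun x => (ENNReal.ofReal_le_ofReal (hp x)).trans ?_
        rw [ENNReal.ofReal_add (by norm_num) (by positivity), ENNReal.ofReal_mul (by norm_num)]
    _ ≤ ENNReal.ofReal (9 / 10) + ENNReal.ofReal (3 / 10) * 2 := by
        rw [lintegral_add_left measurable_const, lintegral_const_mul _ (by fun_prop)]
        simp only [lintegral_const, measure_univ, mul_one]
        gcongr
        exact hν.lintegral_exp_norm_sq_le hn
    _ ≤ 2 := by
        rw [show (2 : ℝ≥0∞) = ENNReal.ofReal 2 by simp, ← ENNReal.ofReal_mul (by norm_num),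
          ← ENNReal.ofReal_add (by norm_num) (by norm_num)]
        exact ENNReal.ofReal_le_ofReal (by norm_num)

theorem tildeK_ne_top (hn : 1 ≤ n) : tildeK n ≠ ∞ := by
  refine ne_top_of_le_ne_top (b := ENNReal.ofReal (Real.sqrt (32 * n))) ENNReal.ofReal_ne_top ?_
  refine iSup_le fun ν => iSup_le fun hp => iSup_le fun _ => iSup_le fun hν => ?_
  exact hν.psiTwoNorm_norm_le hn

end

section

variable {n : ℕ} {ν : Measure (EuclideanSpace ℝ (Fin n))}

/-! ### Small Gaussian tilts -/

/-- Strict inequality provides an admissible r < s, so attainment of the infimum is not needed. -/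
lemma lintegral_exp_le_of_psiTwoNorm_lt {f : EuclideanSpace ℝ (Fin n) → ℝ} {s : ℝ}
    (h : psiTwoNorm ν f < ENNReal.ofReal s) :
    ∫⁻ x, ENNReal.ofReal (Real.exp (f x ^ 2 / s ^ 2)) ∂ν ≤ 2 := by
  simp only [psiTwoNorm, iInf_lt_iff] at h
  obtain ⟨r, hr, hr2, hrs⟩ := h
  have hrs' : r < s := (ENNReal.ofReal_lt_ofReal_iff_of_nonneg hr.le).1 hrs
  refine le_trans (lintegral_mono fun x => ENNReal.ofReal_le_ofReal (Real.exp_le_exp.2 ?_)) hr2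
  gcongr

lemma integrable_exp_of_lintegral_le {α : Type*} [MeasurableSpace α] {μ : Measure α}
    {f : α → ℝ} (hf : Measurable f)
    (h : ∫⁻ x, ENNReal.ofReal (Real.exp (f x)) ∂μ ≤ 2) :
    Integrable (fun x => Real.exp (f x)) μ ∧ ∫ x, Real.exp (f x) ∂μ ≤ 2 := by
  have hi : Integrable (fun x => Real.exp (f x)) μ := by
    refine ⟨by fun_prop, ?_⟩
    rw [hasFiniteIntegral_iff_ofReal (ae_of_all _ fun _ => Real.exp_nonneg _)]
    exact h.trans_lt (by simp)
  refine ⟨hi, ?_⟩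
  rw [← ofReal_integral_eq_lintegral_ofReal hi (ae_of_all _ fun _ => Real.exp_nonneg _),
    show (2 : ℝ≥0∞) = ENNReal.ofReal 2 by simp, ENNReal.ofReal_le_ofReal_iff (by norm_num)] at h
  exact h

/-- Data on the norm of a centered tilt-stable random vector. -/
lemma IsTiltStable.norm_moments [IsProbabilityMeasure ν] (hν : IsTiltStable 1 ν)
    (hb : ∫ y, y ∂ν = 0) {s : ℝ} (hs : 0 < s)
    (h : ∫⁻ x, ENNReal.ofReal (Real.exp ((‖x‖ - ∫ y, ‖y‖ ∂ν) ^ 2 / s ^ 2)) ∂ν ≤ 2) :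
    (∫ y, ‖y‖ ∂ν) ^ 2 ≤ n ∧ ∫ x, ‖x‖ ^ 2 ∂ν ≤ (∫ y, ‖y‖ ∂ν) ^ 2 + s ^ 2 ∧
      ∫ x, ‖x‖ ^ 2 ∂ν ≤ n := by
  have hE := hν.hasExpMoments
  have hL : MemLp (fun x : EuclideanSpace ℝ (Fin n) => ‖x‖) 2 ν := (hE.memLp_id 2).norm
  have hv := variance_eq_sub hL
  have hv2 := variance_eq_integral hL.1.aemeasurable
  simp only [Pi.pow_apply] at hv
  have hn := hν.integral_norm_sub_sq_le
  simp only [hb, sub_zero] at hn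
  have hv0 := variance_nonneg (fun x : EuclideanSpace ℝ (Fin n) => ‖x‖) ν
  refine ⟨by linarith, ?_, hn⟩
  obtain ⟨hi, hle⟩ := integrable_exp_of_lintegral_le (by fun_prop) h
  have hsq : Integrable (fun x : EuclideanSpace ℝ (Fin n) => (‖x‖ - ∫ y, ‖y‖ ∂ν) ^ 2 / s ^ 2) ν :=
    (hL.sub (memLp_const _)).integrable_sq.div_const _
  -- Since 1 + z ≤ e^z, the Ψ₂ bound gives Var|X| ≤ s².
  have h1 : ∫ x, ((‖x‖ - ∫ y, ‖y‖ ∂ν) ^ 2 / s ^ 2 + 1) ∂ν ≤ 2 :=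
    (integral_mono (hsq.add (integrable_const _)) hi fun x => Real.add_one_le_exp _).trans hle
  rw [integral_add hsq (integrable_const _), integral_div, ← hv2] at h1
  simp only [integral_const, probReal_univ, smul_eq_mul, mul_one] at h1
  have h2 : Var[fun x : EuclideanSpace ℝ (Fin n) => ‖x‖; ν] / s ^ 2 ≤ 1 := by linarith
  rw [div_le_one (by positivity)] at h2
  linarith

lemma integrable_exp_neg_mul_norm_sq [IsFiniteMeasure ν] {t : ℝ} (ht : 0 ≤ t) :
    Integrable (fun x => Real.exp (-t * ‖x‖ ^ 2)) ν := by
  refine Integrable.of_bound (by fun_prop) 1 (ae_of_all _ fun x => ?_)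
  rw [Real.norm_eq_abs, Real.abs_exp, Real.exp_le_one_iff]
  have := sq_nonneg ‖x‖
  nlinarith

/-- Second moments of a centered tilt-stable measure after a Gaussian tilt. -/
lemma IsTiltStable.integral_sq_tilted_le [IsProbabilityMeasure ν] (hν : IsTiltStable 1 ν)
    (hb : ∫ y, y ∂ν = 0) {s : ℝ} (hs : 0 < s)
    (h : ∫⁻ x, ENNReal.ofReal (Real.exp ((‖x‖ - ∫ y, ‖y‖ ∂ν) ^ 2 / s ^ 2)) ∂ν ≤ 2)
    {t : ℝ} (ht : 0 < t) {θ : EuclideanSpace ℝ (Fin n)} (hθ : ‖θ‖ ≤ 1) :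
    Integrable (fun x => ⟪θ, x⟫ ^ 2) (ν.tilted fun x => -t * ‖x‖ ^ 2) ∧
    ∫ x, ⟪θ, x⟫ ^ 2 ∂(ν.tilted fun x => -t * ‖x‖ ^ 2) ≤
      8 * (1 + 2 * t ^ 2 * n * s ^ 2 + t * (s * Real.sqrt n)) := by
  have hE := hν.hasExpMoments
  obtain ⟨hm, hv1, hv2⟩ := hν.norm_moments hb hs h
  set m := ∫ y, ‖y‖ ∂ν with hmdef
  obtain ⟨hi1, hle1⟩ := integrable_exp_of_lintegral_le (by fun_prop) h
  have h2 := hν.lintegral_exp_sq_le hθ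
  simp only [hb, sub_zero] at h2
  obtain ⟨hi2, hle2⟩ := integrable_exp_of_lintegral_le (by fun_prop) h2
  have hZ : Integrable (fun x => Real.exp (-t * ‖x‖ ^ 2)) ν :=
    integrable_exp_neg_mul_norm_sq ht.le
  set ρ := ν.tilted fun x => -t * ‖x‖ ^ 2 with hρ
  have : IsProbabilityMeasure ρ :=
    MeasureTheory.isProbabilityMeasure_tilted hZ
  have hpt : ∀ x : EuclideanSpace ℝ (Fin n), Real.exp (-t * ‖x‖ ^ 2 + ⟪θ, x⟫ ^ 2 / 8) ≤
      Real.exp (-t * m ^ 2 + 2 * t ^ 2 * n * s ^ 2) *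
        (1 / 2 * (Real.exp ((‖x‖ - m) ^ 2 / s ^ 2) + Real.exp (⟪θ, x⟫ ^ 2 / 4))) := fun x => by
    have h1 : -t * ‖x‖ ^ 2 + ⟪θ, x⟫ ^ 2 / 8 ≤ (-t * m ^ 2 + 2 * t ^ 2 * n * s ^ 2) +
        ((‖x‖ - m) ^ 2 / s ^ 2 / 2 + ⟪θ, x⟫ ^ 2 / 4 / 2) := by
      -- Expanding |x|² around m, the cross term -2tm(|x| - m) is at most (|x| - m)²/(2s²) +
      -- 2t²m²s²; the term -t(|x| - m)² is dropped.
      have h3 : 0 ≤ ((‖x‖ - m) / s + 2 * t * m * s) ^ 2 := sq_nonneg _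
      have h4 : ((‖x‖ - m) / s + 2 * t * m * s) ^ 2 =
        (‖x‖ - m) ^ 2 / s ^ 2 + 4 * t * m * (‖x‖ - m) + 4 * t ^ 2 * m ^ 2 * s ^ 2 := by
        field_simp
        ring
      have h5 : t ^ 2 * s ^ 2 * m ^ 2 ≤ t ^ 2 * s ^ 2 * n := by gcongr
      have h6 : 0 ≤ t * (‖x‖ - m) ^ 2 := by positivity
      nlinarith
    refine (Real.exp_le_exp.2 h1).trans ?_
    rw [Real.exp_add]
    refine mul_le_mul_of_nonneg_left ?_ (Real.exp_nonneg _)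
    have e1 : ∀ z : ℝ, Real.exp z = Real.exp (z / 2) ^ 2 := fun z => by
      rw [← Real.exp_nat_mul]; congr 1; push_cast; ring
    rw [Real.exp_add, e1 ((‖x‖ - m) ^ 2 / s ^ 2), e1 (⟪θ, x⟫ ^ 2 / 4)]
    nlinarith [sq_nonneg (Real.exp ((‖x‖ - m) ^ 2 / s ^ 2 / 2) - Real.exp (⟪θ, x⟫ ^ 2 / 4 / 2))]
  have hdom := ((hi1.add hi2).const_mul (1 / 2)).const_mul
    (Real.exp (-t * m ^ 2 + 2 * t ^ 2 * n * s ^ 2))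
  have hnumi : Integrable (fun x => Real.exp (-t * ‖x‖ ^ 2 + ⟪θ, x⟫ ^ 2 / 8)) ν := by
    refine hdom.mono' (by fun_prop) (ae_of_all _ fun x => ?_)
    rw [Real.norm_eq_abs, Real.abs_exp]
    exact hpt x
  have hnum : ∫ x, Real.exp (-t * ‖x‖ ^ 2 + ⟪θ, x⟫ ^ 2 / 8) ∂ν ≤
      Real.exp (-t * m ^ 2 + 2 * t ^ 2 * n * s ^ 2) * 2 := by
    refine (integral_mono hnumi hdom hpt).trans ?_
    rw [integral_const_mul, integral_const_mul]
    refine mul_le_mul_of_nonneg_left ?_ (Real.exp_nonneg _)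
    simp only [Pi.add_apply]
    rw [integral_add hi1 hi2]
    linarith
  have hnsq : Integrable (fun x => ‖x‖ ^ 2) ν := by
    simpa using hE.integrable_norm_sub_sq 0
  -- Jensen bounds the normalizing constant from below, so the factor e^{-tm²} cancels in the
  -- quotient up to e^{ts√n}.
  have hden : Real.exp (-t * ∫ x, ‖x‖ ^ 2 ∂ν) ≤ ∫ x, Real.exp (-t * ‖x‖ ^ 2) ∂ν := by
    rw [← integral_const_mul]
    exact exp_integral_le (hnsq.const_mul (-t)) hZ
  have hvs : ∫ x, ‖x‖ ^ 2 ∂ν ≤ m ^ 2 + s * Real.sqrt n := by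
    have hsn := Real.sqrt_nonneg (n : ℝ)
    have hsn2 := Real.sq_sqrt (Nat.cast_nonneg (α := ℝ) n)
    -- If s ≤ √n, then s² ≤ s√n; otherwise E|X|² ≤ n ≤ s√n already.
    rcases le_total s (Real.sqrt n) with hc | hc <;> nlinarith [sq_nonneg m]
  have hqi : Integrable (fun x => Real.exp (⟪θ, x⟫ ^ 2 / 8)) ρ := by
    rw [hρ, integrable_tilted_iff hZ]
    refine hnumi.congr (ae_of_all _ fun x => ?_)
    simp only [smul_eq_mul, Real.exp_add]
  have hqsi : Integrable (fun x => ⟪θ, x⟫ ^ 2 / 8) ρ := by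
    refine hqi.mono' (by fun_prop) (ae_of_all _ fun x => ?_)
    rw [Real.norm_eq_abs, abs_of_nonneg (by positivity)]
    linarith [Real.add_one_le_exp (⟪θ, x⟫ ^ 2 / 8)]
  have hq : ∫ x, Real.exp (⟪θ, x⟫ ^ 2 / 8) ∂ρ ≤
      Real.exp (1 + 2 * t ^ 2 * n * s ^ 2 + t * (s * Real.sqrt n)) := by
    rw [hρ, integral_exp_tilted, div_le_iff₀ (integral_exp_pos hZ)]
    simp only [Pi.add_apply]
    calc _ ≤ Real.exp (-t * m ^ 2 + 2 * t ^ 2 * n * s ^ 2) * 2 := hnum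
      _ ≤ Real.exp (-t * m ^ 2 + 2 * t ^ 2 * n * s ^ 2) * Real.exp 1 := by
          gcongr
          linarith [Real.add_one_le_exp 1]
      _ = Real.exp (1 + 2 * t ^ 2 * n * s ^ 2 + t * (s * Real.sqrt n)) *
          Real.exp (-t * (m ^ 2 + s * Real.sqrt n)) := by
          rw [← Real.exp_add, ← Real.exp_add]; ring_nf
      _ ≤ Real.exp (1 + 2 * t ^ 2 * n * s ^ 2 + t * (s * Real.sqrt n)) *
          Real.exp (-t * ∫ x, ‖x‖ ^ 2 ∂ν) := by
          refine mul_le_mul_of_nonneg_left (Real.exp_le_exp.2 ?_) (Real.exp_nonneg _)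
          nlinarith
      _ ≤ _ := mul_le_mul_of_nonneg_left hden (Real.exp_nonneg _)
  have hj := Real.exp_le_exp.1 ((exp_integral_le hqsi hqi).trans hq)
  rw [integral_div] at hj
  refine ⟨?_, by linarith⟩
  refine (hqsi.mul_const 8).congr (ae_of_all _ fun x => ?_)
  simp

/-- Covariance of a centered tilt-stable measure after a Gaussian tilt. -/
theorem IsTiltStable.norm_covarianceBilin_gaussian_le [IsProbabilityMeasure ν]
    (hν : IsTiltStable 1 ν) (hb : ∫ y, y ∂ν = 0) {s : ℝ} (hs : 0 < s)
    (h : ∫⁻ x, ENNReal.ofReal (Real.exp ((‖x‖ - ∫ y, ‖y‖ ∂ν) ^ 2 / s ^ 2)) ∂ν ≤ 2)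
    {t : ℝ} (ht : 0 < t) :
    ‖covarianceBilin (ν.tilted fun x => -t * ‖x‖ ^ 2)‖ ≤
      8 * (1 + 2 * t ^ 2 * n * s ^ 2 + t * (s * Real.sqrt n)) := by
  have hZ : Integrable (fun x => Real.exp (-t * ‖x‖ ^ 2)) ν :=
    integrable_exp_neg_mul_norm_sq ht.le
  have : IsProbabilityMeasure (ν.tilted fun x => -t * ‖x‖ ^ 2) :=
    MeasureTheory.isProbabilityMeasure_tilted hZ
  have hmem : MemLp id 2 (ν.tilted fun x => -t * ‖x‖ ^ 2) := by
    refine MemLp.of_eval_piLp fun i => ?_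
    have := (hν.integral_sq_tilted_le hb hs h ht
      (θ := EuclideanSpace.single i (1 : ℝ)) (by simp)).1
    rw [← memLp_two_iff_integrable_sq (by fun_prop)] at this
    refine this.congr_norm (by fun_prop) (ae_of_all _ fun x => ?_)
    simp [EuclideanSpace.inner_single_left]
  refine norm_covarianceBilin_le hmem (by positivity) fun θ => ?_
  refine (variance_le_expectation_sq (by fun_prop)).trans ?_
  simp only [Pi.pow_apply]
  rcases eq_or_ne θ 0 with rfl | hθ
  · simp
  have hθ' : ‖θ‖ ≠ 0 := norm_ne_zero_iff.2 hθ
  have h1 := (hν.integral_sq_tilted_le hb hs h ht (θ := ‖θ‖⁻¹ • θ)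
    (by rw [norm_smul, norm_inv, norm_norm, inv_mul_cancel₀ hθ'])).2
  simp only [inner_smul_left, mul_pow, integral_const_mul] at h1
  simp only [conj_trivial, inv_pow] at h1
  rwa [inv_mul_le_iff₀ (by positivity), mul_comm] at h1

end

section

variable {n : ℕ}

/-! ### A lower bound on `tildeK` from a Gaussian measure -/

lemma integrable_exp_neg_mul_norm_sq_add {t : ℝ} (ht : 0 < t) (h : EuclideanSpace ℝ (Fin n)) :
    Integrable fun x : EuclideanSpace ℝ (Fin n) => Real.exp (-t * ‖x‖ ^ 2 + ⟪h, x⟫) := by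
  have := (GaussianFourier.integrable_cexp_neg_mul_sq_norm_add
    (V := EuclideanSpace ℝ (Fin n)) (b := (t : ℂ)) (by simpa using ht) 1 h).norm
  refine this.congr (ae_of_all _ fun x => ?_)
  simp only [Complex.norm_exp]
  congr 1
  norm_cast
  simp

lemma isLogConcave_volume : IsLogConcave (volume : Measure (EuclideanSpace ℝ (Fin n))) :=
  ⟨Set.univ, fun _ => 0, convexOn_const 0 convex_univ, by simp⟩

lemma integrable_exp_neg_mul_norm_sq_volume {t : ℝ} (ht : 0 < t) :
    Integrable fun x : EuclideanSpace ℝ (Fin n) => Real.exp (-t * ‖x‖ ^ 2) := by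
  simpa using integrable_exp_neg_mul_norm_sq_add ht (0 : EuclideanSpace ℝ (Fin n))

/-- The centered Gaussian measure with density proportional to `exp (-2 |x|²)`. -/
noncomputable def gaussian (n : ℕ) : Measure (EuclideanSpace ℝ (Fin n)) :=
  volume.tilted fun x => -2 * ‖x‖ ^ 2

instance : IsProbabilityMeasure (gaussian n) :=
  isProbabilityMeasure_tilted (integrable_exp_neg_mul_norm_sq_volume two_pos)

lemma isLogConcave_gaussian : IsLogConcave (gaussian n) := by
  set Z := ∫ x : EuclideanSpace ℝ (Fin n), Real.exp (-2 * ‖x‖ ^ 2)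
  have hZ : 0 < Z := integral_exp_pos (integrable_exp_neg_mul_norm_sq_volume two_pos)
  refine ⟨Set.univ, fun x => 2 * ‖x‖ ^ 2 + Real.log Z, ?_, ?_⟩
  · exact (((convexOn_norm convex_univ).pow (fun _ _ => norm_nonneg _) 2).smul
      (zero_le_two (α := ℝ))).add_const _
  · rw [gaussian, Measure.tilted, Set.indicator_univ]
    congr 1
    ext x
    rw [neg_add, Real.exp_add, Real.exp_neg (Real.log Z), Real.exp_log hZ, neg_mul, div_eq_mul_inv]

/-- Its linear tilts are Gaussian tilts of Lebesgue measure with t = 2, so the 1/t bound gives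
covariance at most 1/2. -/
lemma isTiltStable_gaussian : IsTiltStable 1 (gaussian n) := by
  have hE : HasExpMoments (gaussian n) := fun h => by
    rw [gaussian, integrable_tilted_iff (integrable_exp_neg_mul_norm_sq_volume two_pos)]
    refine (integrable_exp_neg_mul_norm_sq_add two_pos h).congr (ae_of_all _ fun x => ?_)
    simp only [smul_eq_mul, Real.exp_add]
  refine ⟨one_pos, fun h => ⟨⟨hE h, integral_exp_pos (hE h)⟩, ?_⟩⟩
  rw [gaussian, tilted_tilted (integrable_exp_neg_mul_norm_sq_volume two_pos)]
  refine (norm_covarianceBilin_tilted_le isLogConcave_volume (NeZero.ne _) two_pos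
    (integrable_exp_neg_mul_norm_sq_add two_pos) h).trans (by norm_num)

lemma integral_gaussian_eq_zero : ∫ x, x ∂(gaussian n) = 0 := by
  rw [gaussian, integral_tilted]
  set I := ∫ x : EuclideanSpace ℝ (Fin n), (Real.exp (-2 * ‖x‖ ^ 2) /
    ∫ x : EuclideanSpace ℝ (Fin n), Real.exp (-2 * ‖x‖ ^ 2)) • x with hI
  have h : I = -I := by
    nth_rw 1 [hI]
    rw [← integral_neg_eq_self, hI, ← integral_neg]
    simp
  have h2 : (2 : ℝ) • I = 0 := by
    rw [two_smul]
    nth_rw 2 [h]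
    simp
  simpa using h2

lemma integral_exp_gaussian {t : ℝ} (ht : 0 < t) :
    ∫ x, Real.exp (-t * ‖x‖ ^ 2) ∂(gaussian n) =
      Real.exp (-(n / 2) * Real.log (1 + t / 2)) := by
  have hpi := Real.pi_pos
  have e : ∀ c : ℝ, 0 < c → ∫ x : EuclideanSpace ℝ (Fin n), Real.exp (-c * ‖x‖ ^ 2) =
      Real.exp ((Real.log Real.pi - Real.log c) * (n / 2)) := fun c hc => by
    rw [GaussianFourier.integral_rexp_neg_mul_sq_norm hc, finrank_euclideanSpace_fin,
      Real.rpow_def_of_pos (by positivity), Real.log_div hpi.ne' hc.ne']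
  rw [gaussian, integral_exp_tilted]
  have e2 : ((fun x : EuclideanSpace ℝ (Fin n) => -2 * ‖x‖ ^ 2) + fun x => -t * ‖x‖ ^ 2) =
      fun x => -(2 + t) * ‖x‖ ^ 2 := by
    ext x
    simp only [Pi.add_apply]; ring
  rw [e2]
  rw [e _ (by positivity), e _ two_pos, ← Real.exp_sub]
  have : 1 + t / 2 = (2 + t) / 2 := by ring
  rw [this, Real.log_div (by positivity) (by norm_num)]
  ring_nf

/-- If s were below 1/100, |X| would be nearly constant, with m² at least about 0.17n. Then E
e^{-40|X|²} would be at most about e^{-40m²}, far below its true value 21^{-n/2}. -/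
lemma le_of_lintegral_exp_gaussian_le (hn : 1 ≤ n) {s : ℝ} (hs : 0 < s)
    (h : ∫⁻ x, ENNReal.ofReal (Real.exp ((‖x‖ - ∫ y, ‖y‖ ∂(gaussian n)) ^ 2 / s ^ 2))
      ∂(gaussian n) ≤ 2) : 1 / 100 ≤ s := by
  have hn1 : (1 : ℝ) ≤ n := by exact_mod_cast hn
  have hγ := isTiltStable_gaussian (n := n)
  obtain ⟨hm, hv, -⟩ := hγ.norm_moments integral_gaussian_eq_zero hs h
  set m := ∫ y, ‖y‖ ∂(gaussian n)
  obtain ⟨hi, hle⟩ := integrable_exp_of_lintegral_le (by fun_prop) h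
  have hint : ∀ t : ℝ, 0 < t → Integrable (fun x => Real.exp (-t * ‖x‖ ^ 2)) (gaussian n) :=
    fun t ht => integrable_exp_neg_mul_norm_sq ht.le
  have hsq : Integrable (fun x => ‖x‖ ^ 2) (gaussian n) := by
    simpa using hγ.hasExpMoments.integrable_norm_sub_sq 0
  -- Jensen applied to the explicit value E e^{-2|X|²} = 2^{-n/2}.
  have hlow : n / 4 * Real.log 2 ≤ ∫ x, ‖x‖ ^ 2 ∂(gaussian n) := by
    have h1 := exp_integral_le (hsq.const_mul (-2)) (hint 2 two_pos)
    rw [integral_exp_gaussian two_pos, integral_const_mul, Real.exp_le_exp] at h1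
    norm_num at h1
    linarith
  have hup : Real.exp (-(n / 2) * Real.log (1 + 40 / 2)) ≤
      Real.exp (-40 * m ^ 2 + 1600 * n * s ^ 2) * Real.exp 1 := by
    rw [← integral_exp_gaussian (by norm_num : (0 : ℝ) < 40)]
    have hpt : ∀ x : EuclideanSpace ℝ (Fin n), Real.exp (-40 * ‖x‖ ^ 2) ≤
        Real.exp (-40 * m ^ 2 + 1600 * n * s ^ 2) * Real.exp ((‖x‖ - m) ^ 2 / s ^ 2) := fun x => by
      rw [← Real.exp_add, Real.exp_le_exp]
      have h3 : 0 ≤ ((‖x‖ - m) / s + 40 * m * s) ^ 2 := sq_nonneg _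
      have h4 : ((‖x‖ - m) / s + 40 * m * s) ^ 2 =
        (‖x‖ - m) ^ 2 / s ^ 2 + 80 * m * (‖x‖ - m) + 1600 * m ^ 2 * s ^ 2 := by
        field_simp
        ring
      have h5 : s ^ 2 * m ^ 2 ≤ s ^ 2 * n := by gcongr
      nlinarith [sq_nonneg (‖x‖ - m)]
    refine (integral_mono (hint 40 (by norm_num)) (hi.const_mul _) hpt).trans ?_
    rw [integral_const_mul]
    refine mul_le_mul_of_nonneg_left (hle.trans ?_) (Real.exp_nonneg _)
    linarith [Real.add_one_le_exp 1]
  rw [← Real.exp_add, Real.exp_le_exp] at hup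
  have hlog : Real.log (1 + 40 / 2) ≤ 5 * Real.log 2 := by
    rw [show (5 : ℝ) * Real.log 2 = Real.log (2 ^ 5) by rw [Real.log_pow]; norm_num]
    exact Real.log_le_log (by norm_num) (by norm_num)
  have hl1 := Real.log_two_gt_d9
  have hl2 := Real.log_two_lt_d9
  by_contra! hlt
  have hs2 : s ^ 2 ≤ 1 / 10000 := by nlinarith
  have h1 : (n : ℝ) * s ^ 2 ≤ n * (1 / 10000) := by gcongr
  have h2 : (n : ℝ) * Real.log (1 + 40 / 2) ≤ n * (5 * 0.7) := by
    refine mul_le_mul_of_nonneg_left ?_ (by positivity)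
    linarith
  have h3 : (n : ℝ) * 0.69 ≤ n * Real.log 2 := by
    refine mul_le_mul_of_nonneg_left ?_ (by positivity)
    linarith
  norm_num at hup h2 h3
  linarith

theorem le_tildeK (hn : 1 ≤ n) : ENNReal.ofReal (1 / 100) ≤ tildeK n := by
  have h1 : psiTwoNorm (gaussian n) (fun x => ‖x‖ - ∫ y, ‖y‖ ∂(gaussian n)) ≤ tildeK n :=
    le_iSup_of_le (gaussian n) (le_iSup_of_le inferInstance
      (le_iSup_of_le isLogConcave_gaussian (le_iSup_of_le isTiltStable_gaussian le_rfl)))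
  refine le_trans ?_ h1
  exact le_iInf fun s => le_iInf fun hs => le_iInf fun h =>
    ENNReal.ofReal_le_ofReal (le_of_lintegral_exp_gaussian_le hn hs h)

end

section

variable {n : ℕ} {μ : Measure (EuclideanSpace ℝ (Fin n))}

/-! ### Translations -/

lemma withDensity_map_equiv {α : Type*} [MeasurableSpace α] (μ : Measure α) (e : α ≃ᵐ α)
    (f : α → ℝ≥0∞) : (μ.map e).withDensity f = (μ.withDensity fun x => f (e x)).map e := by
  ext s hs
  rw [withDensity_apply _ hs, e.map_apply, withDensity_apply _ (e.measurable hs),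
    e.restrict_map, lintegral_map_equiv]

lemma tilted_map_equiv {α : Type*} [MeasurableSpace α] (μ : Measure α) (e : α ≃ᵐ α)
    (f : α → ℝ) : (μ.map e).tilted f = (μ.tilted fun x => f (e x)).map e := by
  rw [Measure.tilted, integral_map_equiv, withDensity_map_equiv]
  rfl

lemma IsLogConcave.tilted (hμ : IsLogConcave μ) {h : EuclideanSpace ℝ (Fin n)}
    (hi : Integrable (fun x => Real.exp ⟪h, x⟫) μ) (hμ0 : μ ≠ 0) :
    IsLogConcave (μ.tilted fun x => ⟪h, x⟫) := by
  have : NeZero μ := ⟨hμ0⟩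
  have hZ : 0 < ∫ x, Real.exp ⟪h, x⟫ ∂μ := integral_exp_pos hi
  set Z := ∫ x, Real.exp ⟪h, x⟫ ∂μ with hZdef
  obtain ⟨K, V, hV, hm, hμe⟩ := hμ.exists_measurable_density
  refine ⟨K, fun x => V x - ⟪h, x⟫ + Real.log Z, ?_, ?_⟩
  · have hlin : ConcaveOn ℝ K fun x => ⟪h, x⟫ := (innerₛₗ ℝ h).concaveOn hV.1
    exact (hV.sub hlin).add_const _
  · rw [Measure.tilted, ← hZdef]
    nth_rw 1 [hμe]
    rw [← withDensity_mul _ hm (by fun_prop)]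
    congr 1
    ext x
    by_cases hx : x ∈ K
    · simp only [Pi.mul_apply, Set.indicator_of_mem hx]
      rw [← ENNReal.ofReal_mul (Real.exp_nonneg _)]
      congr 1
      rw [show -(V x - ⟪h, x⟫ + Real.log Z) = -V x + (⟪h, x⟫ - Real.log Z) by ring, Real.exp_add,
        Real.exp_sub, Real.exp_log hZ]
    · simp [hx]

lemma IsLogConcave.map_add_left (hμ : IsLogConcave μ) (c : EuclideanSpace ℝ (Fin n)) :
    IsLogConcave (μ.map fun x => c + x) := by
  obtain ⟨K, V, hV, rfl⟩ := hμ
  refine ⟨(fun x => -c + x) ⁻¹' K, fun x => V (-c + x), ?_, ?_⟩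
  · exact hV.translate_right (-c)
  · have h := withDensity_map_equiv volume (MeasurableEquiv.addLeft c)
      (((fun x => -c + x) ⁻¹' K).indicator fun x => ENNReal.ofReal (Real.exp (-V (-c + x))))
    rw [MeasurableEquiv.coe_addLeft, (measurePreserving_add_left volume c).map_eq] at h
    rw [h]
    congr 2
    ext x
    by_cases hx : x ∈ K <;> simp [hx]

lemma IsTiltStable.map_add_left {β : ℝ} (hμ : IsTiltStable β μ) (c : EuclideanSpace ℝ (Fin n)) :
    IsTiltStable β (μ.map fun x => c + x) := by
  have hE : HasExpMoments (μ.map fun x => c + x) := fun h => by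
    rw [integrable_map_measure (by fun_prop) (by fun_prop)]
    simp only [Function.comp_def, inner_add_right, Real.exp_add]
    exact (hμ.hasExpMoments h).const_mul _
  have : NeZero (μ.map fun x => c + x) :=
    ⟨(Measure.map_ne_zero_iff (by fun_prop)).2 hμ.ne_zero⟩
  refine ⟨hμ.1, fun h => ⟨⟨hE h, integral_exp_pos (hE h)⟩, ?_⟩⟩
  have h1 := tilted_map_equiv μ (MeasurableEquiv.addLeft c) fun x => ⟪h, x⟫
  simp only [MeasurableEquiv.coe_addLeft, inner_add_right] at h1
  have h2 : (μ.tilted fun x => ⟪h, c⟫ + ⟪h, x⟫) = μ.tilted fun x => ⟪h, x⟫ := by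
    simp only [add_comm ⟪h, c⟫]
    exact tilted_add_const _ _ _
  have := hμ.isProbabilityMeasure_tilted h
  rw [h1, h2, covarianceBilin_map_const_add]
  exact (hμ.2 h).2

/-! ### Centering a Gaussian tilt -/

/-- A finite convex function on a finite-dimensional space is continuous. -/
lemma HasExpMoments.continuous_integral_exp (hμ : HasExpMoments μ) :
    Continuous fun w => ∫ x, Real.exp ⟪w, x⟫ ∂μ := by
  have hc : ConvexOn ℝ Set.univ fun w => ∫ x, Real.exp ⟪w, x⟫ ∂μ := by
    refine ⟨convex_univ, fun v _ w _ a b ha hb hab => ?_⟩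
    simp only [smul_eq_mul]
    rw [← integral_const_mul, ← integral_const_mul,
      ← integral_add ((hμ v).const_mul a) ((hμ w).const_mul b)]
    refine integral_mono (hμ _) (((hμ v).const_mul a).add ((hμ w).const_mul b)) fun x => ?_
    have := convexOn_exp.2 (Set.mem_univ ⟪v, x⟫) (Set.mem_univ ⟪w, x⟫) ha hb hab
    simpa [inner_add_left, inner_smul_left] using this
  rw [← continuousOn_univ]
  exact hc.continuousOn isOpen_univ

/-- For every `h` there is a linear tilt `w` of `μ` such that `w` plus `2 t` times the barycenter
of the tilted measure is `h`. -/
lemma exists_add_smul_barycenter_eq (hμ : HasExpMoments μ) (hμ0 : μ ≠ 0) {t : ℝ} (ht : 0 < t)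
    (h : EuclideanSpace ℝ (Fin n)) :
    ∃ w : EuclideanSpace ℝ (Fin n),
      w + (2 * t) • ∫ x, x ∂(μ.tilted fun x => ⟪w, x⟫) = h := by
  have : NeZero μ := ⟨hμ0⟩
  set F : EuclideanSpace ℝ (Fin n) → ℝ := fun w => ∫ x, Real.exp ⟪w, x⟫ ∂μ with hF
  have hFpos : ∀ w, 0 < F w := fun w => integral_exp_pos (hμ w)
  have hprob : ∀ w, IsProbabilityMeasure (μ.tilted fun x => ⟪w, x⟫) := fun w =>
    isProbabilityMeasure_tilted (hμ w)
  have hFadd : ∀ w v, F (w + v) = F w * ∫ x, Real.exp ⟪v, x⟫ ∂(μ.tilted fun x => ⟪w, x⟫) := by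
    intro w v
    have h1 := integral_exp_tilted (μ := μ) (fun x => ⟪w, x⟫) fun x => ⟪v, x⟫
    rw [h1, mul_div_cancel₀ _ (hFpos w).ne']
    simp [hF, inner_add_left]
  -- The gradient of log F at w is the barycenter of the tilt by w, so the critical points of φ are
  -- exactly the solutions sought.
  set φ : EuclideanSpace ℝ (Fin n) → ℝ :=
    fun w => ‖w‖ ^ 2 / 2 + 2 * t * Real.log (F w) - ⟪h, w⟫ with hφ
  have hφc : Continuous φ := by
    have h1 : Continuous fun w => Real.log (F w) :=
      hμ.continuous_integral_exp.log fun w => (hFpos w).ne'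
    fun_prop
  set b := ∫ x, x ∂(μ.tilted fun x => ⟪(0 : EuclideanSpace ℝ (Fin n)), x⟫) with hb
  -- Coercivity: by Jensen log F decreases at most linearly, so the quadratic term dominates and a
  -- minimizer exists.
  have hlow : ∀ w, ‖w‖ * (1 / 2 * ‖w‖ + -(2 * t * ‖b‖ + ‖h‖)) + 2 * t * Real.log (F 0) ≤ φ w := by
    intro w
    have hE := hμ.tilted 0
    have h1 : Real.exp ⟪w, b⟫ ≤ ∫ x, Real.exp ⟪w, x⟫
        ∂(μ.tilted fun x => ⟪(0 : EuclideanSpace ℝ (Fin n)), x⟫) := by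
      rw [hb, ← hE.integral_inner]
      exact exp_integral_le ((hE.memLp_inner w 1).integrable le_rfl) (hE w)
    have h2 : Real.log (F 0) + ⟪w, b⟫ ≤ Real.log (F w) := by
      have h3 := hFadd 0 w
      rw [zero_add] at h3
      rw [h3, Real.log_mul (hFpos 0).ne' ((Real.exp_pos _).trans_le h1).ne']
      gcongr
      rw [Real.le_log_iff_exp_le ((Real.exp_pos _).trans_le h1)]
      exact h1
    have h4 : -(‖w‖ * ‖b‖) ≤ ⟪w, b⟫ := (abs_le.1 (abs_real_inner_le_norm w b)).1
    have h5 := real_inner_le_norm h w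
    have h6 : 2 * t * (Real.log (F 0) + -(‖w‖ * ‖b‖)) ≤ 2 * t * Real.log (F w) := by
      refine mul_le_mul_of_nonneg_left ?_ (by positivity)
      linarith
    simp only [hφ]
    nlinarith
  have htend : Filter.Tendsto φ (Filter.cocompact _) Filter.atTop := by
    have h1 : Filter.Tendsto (fun r : ℝ => r * (1 / 2 * r + -(2 * t * ‖b‖ + ‖h‖)) +
        2 * t * Real.log (F 0)) Filter.atTop Filter.atTop :=
      Filter.tendsto_atTop_add_const_right _ _ (Filter.tendsto_id.atTop_mul_atTop₀
        (Filter.tendsto_atTop_add_const_right _ _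
          (Filter.tendsto_id.const_mul_atTop (by norm_num))))
    exact Filter.tendsto_atTop_mono hlow (h1.comp tendsto_norm_cocompact_atTop)
  obtain ⟨w, hw⟩ := hφc.exists_forall_le htend
  refine ⟨w, ?_⟩
  set ν := μ.tilted fun x => ⟪w, x⟫ with hν
  have hE : HasExpMoments ν := hμ.tilted w
  have := hprob w
  have hvar : ∀ v, ⟪w, v⟫ + 2 * t * ⟪v, ∫ x, x ∂ν⟫ - ⟪h, v⟫ = 0 := by
    intro v
    have h0 : (0 : ℝ) ∈ interior (integrableExpSet (fun x => ⟪v, x⟫) ν) := by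
      simp [hE.integrableExpSet_eq]
    have hcgf : HasDerivAt (cgf (fun x => ⟪v, x⟫) ν) ⟪v, ∫ x, x ∂ν⟫ 0 := by
      have h1 := (analyticAt_cgf h0).differentiableAt.hasDerivAt
      rw [deriv_cgf_zero h0, hE.integral_inner] at h1
      simpa using h1
    have hline : ∀ r : ℝ, φ (w + r • v) = ‖w‖ ^ 2 / 2 + r * ⟪w, v⟫ + r ^ 2 * ‖v‖ ^ 2 / 2 +
        2 * t * (Real.log (F w) + cgf (fun x => ⟪v, x⟫) ν r) - (⟪h, w⟫ + r * ⟪h, v⟫) := by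
      intro r
      have h1 : Real.log (F (w + r • v)) = Real.log (F w) + cgf (fun x => ⟪v, x⟫) ν r := by
        rw [hFadd, Real.log_mul (hFpos w).ne' (integral_exp_pos (hE _)).ne', cgf, mgf]
        simp [inner_smul_left, hν]
      simp only [hφ, h1]
      rw [norm_add_sq_real, inner_smul_right, norm_smul, inner_add_right, inner_smul_right, mul_pow,
        Real.norm_eq_abs, sq_abs]
      ring
    have hder : HasDerivAt (fun r : ℝ => φ (w + r • v))
        (⟪w, v⟫ + 2 * t * ⟪v, ∫ x, x ∂ν⟫ - ⟪h, v⟫) 0 := by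
      simp only [hline]
      have d1 : HasDerivAt (fun r : ℝ => ‖w‖ ^ 2 / 2 + r * ⟪w, v⟫) ⟪w, v⟫ 0 :=
        (hasDerivAt_mul_const _).const_add _
      have d2 : HasDerivAt (fun r : ℝ => r ^ 2 * ‖v‖ ^ 2 / 2) 0 0 := by
        have := (((hasDerivAt_id (0 : ℝ)).pow 2).mul_const (‖v‖ ^ 2)).div_const 2
        simpa using this
      have d3 := (hcgf.const_add (Real.log (F w))).const_mul (2 * t)
      have d4 : HasDerivAt (fun r : ℝ => ⟪h, w⟫ + r * ⟪h, v⟫) ⟪h, v⟫ 0 :=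
        (hasDerivAt_mul_const _).const_add _
      have := ((d1.add d2).add d3).sub d4
      rw [add_zero] at this
      exact this
    have hmin : IsLocalMin (fun r : ℝ => φ (w + r • v)) 0 :=
      Filter.Eventually.of_forall fun r => by simpa using hw (w + r • v)
    exact hmin.hasDerivAt_eq_zero hder
  refine ext_inner_right ℝ fun v => ?_
  have := hvar v
  rw [inner_add_left, inner_smul_left, real_inner_comm v (∫ x, x ∂ν)]
  simp only [conj_trivial]
  linarith

/-- A Gaussian tilt of a tilt-stable log-concave measure has the covariance of a centered Gaussian
tilt of some centered one. -/
lemma exists_centered_covarianceBilin_eq (hμ : IsLogConcave μ) (hs : IsTiltStable 1 μ) {t : ℝ}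
    (ht : 0 < t) (h : EuclideanSpace ℝ (Fin n)) :
    ∃ ν : Measure (EuclideanSpace ℝ (Fin n)), IsProbabilityMeasure ν ∧ IsLogConcave ν ∧
      IsTiltStable 1 ν ∧ ∫ x, x ∂ν = 0 ∧
      covarianceBilin (μ.tilted fun x => -t * ‖x‖ ^ 2 + ⟪h, x⟫) =
        covarianceBilin (ν.tilted fun x => -t * ‖x‖ ^ 2) := by
  have hE := hs.hasExpMoments
  obtain ⟨w, hw⟩ := exists_add_smul_barycenter_eq hE hs.ne_zero ht h
  have hp := hs.isProbabilityMeasure_tilted w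
  set ν₀ := μ.tilted fun x => ⟪w, x⟫ with hν₀
  set b := ∫ x, x ∂ν₀ with hb
  have hE₀ : HasExpMoments ν₀ := hE.tilted w
  refine ⟨ν₀.map fun x => -b + x, Measure.isProbabilityMeasure_map (by fun_prop),
    (hμ.tilted (hE w) hs.ne_zero).map_add_left _, (hs.tilted w).map_add_left _, ?_, ?_⟩
  · rw [integral_map (by fun_prop) (by fun_prop), integral_add (integrable_const _) hE₀.integrable_id,
      ← hb]
    simp
  · have h1 := tilted_map_equiv ν₀ (MeasurableEquiv.addLeft (-b)) fun x => -t * ‖x‖ ^ 2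
    simp only [MeasurableEquiv.coe_addLeft] at h1
    have hi : Integrable (fun x => Real.exp (-t * ‖-b + x‖ ^ 2)) ν₀ := by
      refine Integrable.of_bound (by fun_prop) 1 (ae_of_all _ fun x => ?_)
      rw [Real.norm_eq_abs, Real.abs_exp, Real.exp_le_one_iff]
      have := sq_nonneg ‖-b + x‖
      nlinarith
    have := isProbabilityMeasure_tilted hi
    rw [h1, covarianceBilin_map_const_add, hν₀, tilted_tilted (hE w)]
    -- Expanding the square produces the linear term 2t⟨b, x⟩, and w + 2tb = h by the choice of w.
    have h2 : ((fun x => ⟪w, x⟫) + fun x => -t * ‖-b + x‖ ^ 2) =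
        fun x => (-t * ‖x‖ ^ 2 + ⟪h, x⟫) + -t * ‖b‖ ^ 2 := by
      ext x
      simp only [Pi.add_apply, ← hw]
      rw [norm_add_sq_real, norm_neg, inner_neg_left, inner_add_left, inner_smul_left]
      simp only [conj_trivial]
      ring
    rw [h2, tilted_add_const]

end

section

variable {n : ℕ} {μ : Measure (EuclideanSpace ℝ (Fin n))}

/-! ### Strong tilt-stability -/

lemma IsTiltStable.integrable_exp_gaussian {β t : ℝ} (hμ : IsTiltStable β μ) (ht : 0 < t)
    (h : EuclideanSpace ℝ (Fin n)) :
    Integrable (fun x => Real.exp (-t * ‖x‖ ^ 2 + ⟪h, x⟫)) μ := by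
  refine (hμ.hasExpMoments h).mono' (by fun_prop) (ae_of_all _ fun x => ?_)
  rw [Real.norm_eq_abs, Real.abs_exp, Real.exp_le_exp]
  have := sq_nonneg ‖x‖
  nlinarith

lemma one_div_hundred_le_toReal_tildeK (hn : 1 ≤ n) : 1 / 100 ≤ (tildeK n).toReal :=
  (ENNReal.ofReal_le_iff_le_toReal (tildeK_ne_top hn)).1 (le_tildeK hn)

lemma IsTiltStable.norm_covarianceBilin_tilted_le_of_tildeK (hμ : IsLogConcave μ)
    (hs : IsTiltStable 1 μ) (hn : 1 ≤ n) {t : ℝ} (ht : 0 < t) (h : EuclideanSpace ℝ (Fin n)) :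
    ‖covarianceBilin (μ.tilted fun x => -t * ‖x‖ ^ 2 + ⟪h, x⟫)‖ ≤
      8 * (1 + 8 * t ^ 2 * (n * (tildeK n).toReal ^ 2) +
        2 * t * (Real.sqrt n * (tildeK n).toReal)) := by
  obtain ⟨ν, hp, hν, hνs, hb, heq⟩ := exists_centered_covarianceBilin_eq hμ hs ht h
  have hK := one_div_hundred_le_toReal_tildeK hn
  set K := (tildeK n).toReal with hKdef
  have hK0 : 0 < K := lt_of_lt_of_le (by norm_num) hK
  -- Doubling K > 0 makes the inequality strict.
  have hlt : psiTwoNorm ν (fun x => ‖x‖ - ∫ y, ‖y‖ ∂ν) < ENNReal.ofReal (2 * K) := by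
    refine lt_of_le_of_lt (b := tildeK n) ?_ ?_
    · exact le_iSup_of_le ν (le_iSup_of_le hp (le_iSup_of_le hν (le_iSup_of_le hνs le_rfl)))
    · rw [← ENNReal.ofReal_toReal (tildeK_ne_top hn), ← hKdef,
        ENNReal.ofReal_lt_ofReal_iff (by positivity)]
      linarith
  rw [heq]
  refine (hνs.norm_covarianceBilin_gaussian_le hb (by positivity)
    (lintegral_exp_le_of_psiTwoNorm_lt hlt) ht).trans_eq ?_
  ring

end

end TiltStability

theorem mainTheorem6 :
    ∃ C : ℝ, 0 < C ∧ ∀ n : ℕ, 1 ≤ n →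
      TiltStability.tildeK n ≠ ∞ ∧
      ∀ μ : Measure (EuclideanSpace ℝ (Fin n)),
        TiltStability.IsLogConcave μ → TiltStability.IsTiltStable 1 μ →
          TiltStability.IsStronglyTiltStable
            (C * (n : ℝ) ^ (1 / 6 : ℝ) * (TiltStability.tildeK n).toReal ^ (1 / 3 : ℝ)) μ := by
  refine ⟨20, by norm_num, fun n hn => ⟨TiltStability.tildeK_ne_top hn, fun μ hμ hs => ?_⟩⟩
  have hK := TiltStability.one_div_hundred_le_toReal_tildeK hn
  have hn1 : (1 : ℝ) ≤ n := by exact_mod_cast hn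
  have hcov : ∀ t : ℝ, 0 < t → ∀ h : EuclideanSpace ℝ (Fin n), _ := fun t ht h =>
    hs.norm_covarianceBilin_tilted_le_of_tildeK hμ hn ht h
  set K := (TiltStability.tildeK n).toReal
  have hK0 : 0 < K := lt_of_lt_of_le (by norm_num) hK
  set p := (n : ℝ) ^ (1 / 6 : ℝ) * K ^ (1 / 3 : ℝ) with hp
  have hp0 : 0 < p := by positivity
  have hp3 : p ^ 3 = Real.sqrt n * K := by
    rw [hp, mul_pow, ← Real.rpow_natCast, ← Real.rpow_natCast, ← Real.rpow_mul (by positivity),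
      ← Real.rpow_mul (by positivity), Real.sqrt_eq_rpow]
    norm_num
  have hp6 : p ^ 6 = n * K ^ 2 := by
    rw [show p ^ 6 = (p ^ 3) ^ 2 by ring, hp3, mul_pow, Real.sq_sqrt (by positivity)]
  -- p³ = √n K ≥ 1/100 ≥ 1/125.
  have hp5 : 1 / 5 ≤ p := by
    have h1 : (1 / 5 : ℝ) ^ 3 ≤ p ^ 3 := by
      rw [hp3]
      have : 1 ≤ Real.sqrt n := Real.one_le_sqrt.2 hn1
      nlinarith
    exact le_of_pow_le_pow_left₀ (by norm_num) hp0.le h1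
  have : NeZero μ := ⟨hs.ne_zero⟩
  rw [mul_assoc, ← hp]
  refine ⟨by positivity, fun t ht h => ⟨⟨hs.integrable_exp_gaussian ht h,
    integral_exp_pos (hs.integrable_exp_gaussian ht h)⟩, ?_⟩⟩
  -- Above the threshold t = p⁻² the bound 1/t is at most p². Below it, 8(1 + 8p² + 2p) ≤ 344p²
  -- because 1 ≤ 25p² and p ≤ 5p². Both are within (20p)² = 400p².
  rcases le_total 1 (t * p ^ 2) with hc | hc
  · refine (TiltStability.norm_covarianceBilin_tilted_le hμ hs.ne_zero ht
      (fun w => hs.integrable_exp_gaussian ht w) h).trans ?_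
    rw [div_le_iff₀ ht]
    nlinarith
  · refine (hcov t ht h).trans ?_
    rw [← hp3, ← hp6]
    have h1 : t ^ 2 * p ^ 6 ≤ p ^ 2 := by
      have : t ^ 2 * p ^ 6 = (t * p ^ 2) ^ 2 * p ^ 2 := by ring
      rw [this]
      exact mul_le_of_le_one_left (by positivity) (pow_le_one₀ (by positivity) hc)
    have h2 : t * p ^ 3 ≤ p := by
      have : t * p ^ 3 = (t * p ^ 2) * p := by ring
      rw [this]
      exact mul_le_of_le_one_left hp0.le hc
    nlinarith
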